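/- Let $m\ge 4$ be even and let $q$ be a power of $2$. Then the projective symplectic group $\mathrm{PSp}_{2m}(q)=\mathrm{Sp}_{2m}(q)/Z(\mathrm{Sp}_{2m}(q))$ has a proper subgroup $H$ with $\exp(H)=\exp(\mathrm{PSp}_{2m}(q))$, where the exponent of a finite group is the least common multiple of the orders of its elements. An example of such a subgroup is $\Omega^-_{2m}(q)$. Precisely, there are quadratic forms $Q$ of minus type (that is, of Witt index $m-1$) on $\mathbb F_q^{2m}$ whose polar form $Q(x+y)-Q(x)-Q(y)$ is the symplectic form defining $\mathrm{Sp}_{2m}(q)$. For every such $Q$ let $\Omega^-_{2m}(q)=\Omega(Q)$ be the kernel of the Dickson invariant $A\mapsto \operatorname{rank}(A-1)\bmod 2$ on the isometry group of $Q$. Then $\Omega(Q)$ is a proper subgroup of $\mathrm{Sp}_{2m}(q)$ with $\exp(\Omega(Q))=\exp(\mathrm{Sp}_{2m}(q))$; moreover it maps injectively to $\mathrm{PSp}_{2m}(q)$, and its image is a proper subgroup with the same exponent as $\mathrm{PSp}_{2m}(q)$. -/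

import Mathlib

open Matrix Module

/-! ### Parity of the rank of `g - 1` for isometries in characteristic two -/

/-- An alternating bilinear form on a finite-dimensional space has even rank. -/
theorem even_finrank_add_finrank_ker {F : Type*} [Field F] (n : ℕ) :
    ∀ {V : Type _} [AddCommGroup V] [Module F V] [FiniteDimensional F V]
      (B : LinearMap.BilinForm F V), B.IsAlt → finrank F V = n →
      Even (finrank F V + finrank F (LinearMap.ker B)) := by
  induction n using Nat.strong_induction_on with
  | _ n ih =>
    intro V _ _ _ B hB hn
    by_cases h0 : LinearMap.ker B = ⊤
    · rw [h0, finrank_top]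
      exact ⟨_, rfl⟩
    · obtain ⟨x, hx⟩ : ∃ x, B x ≠ 0 := by
        by_contra! h
        exact h0 (by ext v; simp [h v])
      set H : Submodule F V := LinearMap.ker (B x) with hH
      have hxH : x ∈ H := by simp [hH, hB.self_eq_zero x]
      have hcard : finrank F H + 1 = finrank F V := by
        have h1 := LinearMap.finrank_range_add_finrank_ker (B x)
        have h2 : LinearMap.range (B x) = ⊤ := by
          refine LinearMap.range_eq_top.2 ?_
          exact LinearMap.surjective hx
        rw [h2, finrank_top, finrank_self] at h1
        rw [hH]
        omega
      have hR : LinearMap.ker B ≤ H := by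
        intro v hv
        have h1 : B v x = 0 := by rw [LinearMap.mem_ker.1 hv]; rfl
        exact (hB.isRefl v x h1)
      have hle : B.orthogonal H ≤ H := fun y hy => hy x hxH
      have hdim := LinearMap.BilinForm.finrank_add_finrank_orthogonal' (B := B) H
      rw [inf_eq_right.2 hR] at hdim
      have hker : finrank F (LinearMap.ker (B.restrict H)) = finrank F (B.orthogonal H) := by
        have h1 : (LinearMap.ker (B.restrict H)).map H.subtype = B.orthogonal H := by
          apply le_antisymm
          · rintro _ ⟨⟨v, hv⟩, hv2, rfl⟩
            intro w hw
            have := LinearMap.congr_fun (LinearMap.mem_ker.1 hv2) ⟨w, hw⟩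
            exact hB.isRefl _ _ this
          · exact (le_inf hle le_rfl).trans
              (LinearMap.BilinForm.inf_orthogonal_self_le_ker_restrict hB.isRefl)
        rw [← h1, Submodule.finrank_map_subtype_eq]
      have := ih (finrank F H) (by omega) (B.restrict H) (fun v => hB v) rfl
      rw [hker] at this
      obtain ⟨k, hk⟩ := this
      exact ⟨k, by omega⟩

/-- For isometries `g`, `h` of a nondegenerate quadratic form in characteristic two, the rank of
`g * h - 1` has the same parity as the sum of the ranks of `g - 1` and `h - 1`. -/
theorem even_rank_mul_sub_one {F V : Type*} [Field F] [CharP F 2] [AddCommGroup V] [Module F V]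
    [FiniteDimensional F V] (Q : V → F) (B : LinearMap.BilinForm F V) (hB : B.IsAlt)
    (hnd : B.Nondegenerate) (hQ : ∀ x y, Q (x + y) = Q x + Q y + B x y)
    (g h : V →ₗ[F] V) (hg : ∀ v, Q (g v) = Q v) (hh : ∀ v, Q (h v) = Q v) :
    Even (finrank F (LinearMap.range (g * h - 1)) + finrank F (LinearMap.range (g - 1)) +
      finrank F (LinearMap.range (h - 1))) := by
  have two : (2 : F) = 0 := CharTwo.two_eq_zero
  have vtwo : ∀ v : V, v + v = 0 := fun v => by rw [← two_smul F v, two, zero_smul]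
  have vneg : ∀ v : V, -v = v := fun v => by rw [neg_eq_iff_add_eq_zero, vtwo]
  have iso : ∀ f : V →ₗ[F] V, (∀ v, Q (f v) = Q v) → ∀ x y, B (f x) (f y) = B x y := by
    intro f hf x y
    have h1 := hQ (f x) (f y)
    rw [← map_add, hf, hf, hf, hQ x y] at h1
    exact (add_left_cancel h1).symm
  have zero_of : ∀ v, (∀ w, B w v = 0) → v = 0 := fun v hv => hnd.2 v hv
  have surj : ∀ f : V →ₗ[F] V, (∀ v, Q (f v) = Q v) → Function.Surjective f := by
    intro f hf
    apply LinearMap.surjective_of_injective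
    rw [← LinearMap.ker_eq_bot, LinearMap.ker_eq_bot']
    intro v hv
    apply zero_of
    intro w
    rw [← iso f hf, hv, map_zero]
  have orth : ∀ f : V →ₗ[F] V, (∀ v, Q (f v) = Q v) →
      B.orthogonal (LinearMap.range (f - 1)) = LinearMap.ker (f - 1) := by
    intro f hf
    ext y
    constructor
    · intro hy
      rw [LinearMap.mem_ker, LinearMap.sub_apply, Module.End.one_apply]
      apply zero_of
      intro w
      obtain ⟨w, rfl⟩ := surj f hf w
      have h1 : B ((f - 1) w) y = 0 := hy _ ⟨w, rfl⟩
      rw [LinearMap.sub_apply, Module.End.one_apply, map_sub, LinearMap.sub_apply, sub_eq_zero]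
        at h1
      rw [map_sub, iso f hf, h1, sub_self]
    · rintro hy _ ⟨w, rfl⟩
      rw [LinearMap.mem_ker, LinearMap.sub_apply, Module.End.one_apply, sub_eq_zero] at hy
      change B ((f - 1) w) y = 0
      rw [LinearMap.sub_apply, Module.End.one_apply, map_sub, LinearMap.sub_apply]
      nth_rewrite 1 [← hy]
      rw [iso f hf, sub_self]
  have ortho2 : ∀ W : Submodule F V, B.orthogonal (B.orthogonal W) = W :=
    LinearMap.BilinForm.orthogonal_orthogonal hnd hB.isRefl
  have orthsup : ∀ W W' : Submodule F V,
      B.orthogonal (W ⊔ W') = B.orthogonal W ⊓ B.orthogonal W' := by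
    intro W W'
    apply le_antisymm
    · exact le_inf (LinearMap.BilinForm.orthogonal_le le_sup_left)
        (LinearMap.BilinForm.orthogonal_le le_sup_right)
    · rintro y ⟨hy, hy'⟩ v hv
      obtain ⟨a, ha, b, hb, rfl⟩ := Submodule.mem_sup.1 hv
      change B (a + b) y = 0
      rw [map_add, LinearMap.add_apply, hy a ha, hy' b hb, add_zero]
  have alt1 : ∀ f : V →ₗ[F] V, (∀ v, Q (f v) = Q v) → ∀ w, B w ((f - 1) w) = Q ((f - 1) w) := by
    intro f hf w
    have h1 : f w = w + (f - 1) w := by simp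
    have h2 := hQ w ((f - 1) w)
    rw [← h1, hf] at h2
    have h3 : Q ((f - 1) w) + B w ((f - 1) w) = 0 := by linear_combination -h2
    linear_combination h3 - Q ((f - 1) w) * two
  set Ig := LinearMap.range (g - 1)
  set Ih := LinearMap.range (h - 1)
  set Fg := LinearMap.ker (g - 1) with hFg
  set Fh := LinearMap.ker (h - 1) with hFh
  have hog : B.orthogonal Ig = Fg := orth g hg
  have hoh : B.orthogonal Ih = Fh := orth h hh
  have hinf : B.orthogonal (Ig ⊓ Ih) = Fg ⊔ Fh := by
    rw [← ortho2 (Fg ⊔ Fh), orthsup, ← hog, ← hoh, ortho2, ortho2]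
  -- the space of pairs `(w, u)` with `(g - 1) w = (h - 1) u`
  set T : V × V →ₗ[F] V := LinearMap.coprod (g - 1) (h - 1) with hT
  have hTr : LinearMap.range T = Ig ⊔ Ih := LinearMap.range_coprod _ _
  have hmemP : ∀ p : V × V, p ∈ LinearMap.ker T ↔ (g - 1) p.1 = (h - 1) p.2 := by
    intro p
    rw [LinearMap.mem_ker, hT, LinearMap.coprod_apply, ← eq_neg_iff_add_eq_zero, vneg]
  set C : LinearMap.BilinForm F (V × V) :=
    B.compl₁₂ (LinearMap.coprod g LinearMap.id) ((h - 1) ∘ₗ LinearMap.snd F V V) with hC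
  have hCapp : ∀ p p' : V × V, C p p' = B (g p.1 + p.2) ((h - 1) p'.2) := by
    intro p p'
    simp [hC]
  have hCalt : (C.restrict (LinearMap.ker T)).IsAlt := by
    rintro ⟨⟨w, u⟩, hp⟩
    rw [hmemP] at hp
    dsimp only at hp
    change C (w, u) (w, u) = 0
    rw [hCapp]
    dsimp only
    have h1 : g w = w + (g - 1) w := by simp
    rw [map_add, LinearMap.add_apply, alt1 h hh, h1, hp, map_add, LinearMap.add_apply,
      hB.self_eq_zero, ← hp, alt1 g hg]
    linear_combination Q ((g - 1) w) * two
  have key := even_finrank_add_finrank_ker _ _ hCalt rfl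
  -- the radical
  set D : V →ₗ[F] V × V := LinearMap.prod h LinearMap.id with hD
  have hDinj : Function.Injective D := fun a b hab => by
    simpa [hD] using congrArg Prod.snd hab
  have hDapp : ∀ v, D v = (h v, v) := fun _ => rfl
  set Fgh := LinearMap.ker (g * h - 1) with hFgh
  have memF : ∀ (f : V →ₗ[F] V) (v : V), v ∈ LinearMap.ker (f - 1) ↔ f v = v := by
    intro f v
    rw [LinearMap.mem_ker, LinearMap.sub_apply, Module.End.one_apply, sub_eq_zero]
  have hrad : (LinearMap.ker (C.restrict (LinearMap.ker T))).map (LinearMap.ker T).subtype =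
      Fgh.map D ⊔ Fg.prod Fh := by
    apply le_antisymm
    · rintro _ ⟨⟨⟨w, u⟩, hp⟩, hp2, rfl⟩
      rw [hmemP] at hp
      dsimp only at hp
      have h1 : g w + u ∈ B.orthogonal (Ig ⊓ Ih) := by
        rintro x ⟨⟨w', hw'⟩, ⟨u', hu'⟩⟩
        apply hB.isRefl
        have h2 := LinearMap.congr_fun (LinearMap.mem_ker.1 hp2)
          ⟨(w', u'), (hmemP _).2 (hw'.trans hu'.symm)⟩
        change C (w, u) (w', u') = 0 at h2
        rw [hCapp] at h2
        rw [← hu']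
        exact h2
      rw [hinf] at h1
      obtain ⟨a, ha, b, hb, hab⟩ := Submodule.mem_sup.1 h1
      have ha' := (memF g a).1 ha
      have hb' := (memF h b).1 hb
      have e1 : g (w - a) = u - b := by
        have h3 : g w = a + b - u := by rw [hab]; abel
        rw [map_sub, ha', h3, ← vneg (u - b)]
        abel
      have e2 : h (u - b) = w - a := by
        have h5 : g w - w = h u - u := by simpa using hp
        have h6 : g w - a = u - b := by rw [← e1, map_sub, ha']
        rw [map_sub, hb']
        have h7 : h u = u - w + g w := by rw [add_comm_sub, h5]; abel
        have h8 : g w = u - b + a := by rw [← h6]; abel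
        rw [h7, h8]
        have h9 : u - w + (u - b + a) - b = (u + u) - (b + b) + (-w + a) := by abel
        rw [h9, vtwo, vtwo, sub_zero, zero_add, ← vneg (w - a)]
        abel
      refine Submodule.mem_sup.2 ⟨D (u - b), ⟨u - b, ?_, rfl⟩, (a, b), ⟨ha, hb⟩, ?_⟩
      · change u - b ∈ LinearMap.ker (g * h - 1)
        rw [memF, Module.End.mul_apply, e2, e1]
      · rw [hDapp, e2, Prod.mk_add_mk, sub_add_cancel, sub_add_cancel]
        rfl
    · refine sup_le ?_ ?_
      · rintro _ ⟨v, hv, rfl⟩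
        have hv' : g (h v) = v := (memF (g * h) v).1 hv
        have hm : D v ∈ LinearMap.ker T := by
          rw [hmemP]
          rw [hDapp]
          simp only [LinearMap.sub_apply, Module.End.one_apply, hv']
          rw [← vneg (v - h v)]; abel
        refine ⟨⟨D v, hm⟩, ?_, rfl⟩
        refine LinearMap.mem_ker.2 (LinearMap.ext fun p => ?_)
        change C (D v) p.1 = 0
        rw [hCapp]
        simp [hDapp, hv', vtwo]
      · rintro ⟨a, b⟩ ⟨ha, hb⟩
        have ha' := (memF g a).1 ha
        have hb' := (memF h b).1 hb
        have hm : (a, b) ∈ LinearMap.ker T := by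
          rw [hmemP]
          simp [ha', hb']
        refine ⟨⟨(a, b), hm⟩, ?_, rfl⟩
        refine LinearMap.mem_ker.2 (LinearMap.ext fun p => ?_)
        change C (a, b) p.1 = 0
        have hp := (hmemP p.1).1 p.2
        rw [hCapp]
        have h1 : g a + b ∈ B.orthogonal (Ig ⊓ Ih) := by
          rw [hinf]
          exact Submodule.add_mem_sup (by rw [ha']; exact ha) hb
        exact hB.isRefl _ _ (h1 _ ⟨⟨_, hp⟩, ⟨_, rfl⟩⟩)
  have hinter : Fgh.map D ⊓ Fg.prod Fh = (Fg ⊓ Fh).map D := by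
    apply le_antisymm
    · rintro _ ⟨⟨v, hv, rfl⟩, h1, h2⟩
      have h2' : h v = v := (memF h v).1 h2
      have h1' : h v ∈ Fg := h1
      rw [h2'] at h1'
      exact ⟨v, ⟨h1', h2⟩, rfl⟩
    · rintro _ ⟨v, ⟨h1, h2⟩, rfl⟩
      have h1' := (memF g v).1 h1
      have h2' := (memF h v).1 h2
      refine ⟨⟨v, (memF (g * h) v).2 (by rw [Module.End.mul_apply, h2', h1']), rfl⟩, ?_, h2⟩
      change h v ∈ Fg
      rw [h2']
      exact h1
  -- dimension count
  have d1 : finrank F (LinearMap.ker (C.restrict (LinearMap.ker T))) + finrank F ↥(Fg ⊓ Fh) =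
      finrank F Fgh + (finrank F Fg + finrank F Fh) := by
    have h1 := Submodule.finrank_sup_add_finrank_inf_eq (Fgh.map D) (Fg.prod Fh)
    have h2 : ∀ W : Submodule F V, finrank F (W.map D) = finrank F W := fun W =>
      (Submodule.equivMapOfInjective D hDinj W).finrank_eq.symm
    have h3 : finrank F (Fg.prod Fh) = finrank F Fg + finrank F Fh := by
      rw [← Module.finrank_prod]
      let E : ↥(Fg.prod Fh) ≃ₗ[F] Fg × Fh :=
        { toFun := fun x => (⟨x.1.1, x.2.1⟩, ⟨x.1.2, x.2.2⟩)
          invFun := fun y => ⟨(y.1.1, y.2.1), y.1.2, y.2.2⟩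
          map_add' := fun _ _ => rfl
          map_smul' := fun _ _ => rfl
          left_inv := fun _ => rfl
          right_inv := fun _ => rfl }
      exact E.finrank_eq
    rw [hinter, ← hrad, Submodule.finrank_map_subtype_eq, h2, h2, h3] at h1
    exact h1
  have d2 := LinearMap.finrank_range_add_finrank_ker T
  rw [hTr, Module.finrank_prod] at d2
  have d3 : finrank F ↥(Ig ⊔ Ih) + finrank F ↥(Fg ⊓ Fh) = finrank F V := by
    have h1 := LinearMap.BilinForm.finrank_orthogonal hnd (Ig ⊔ Ih)
    rw [orthsup, hog, hoh] at h1
    have := Submodule.finrank_le (Ig ⊔ Ih)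
    omega
  have d4 := LinearMap.finrank_range_add_finrank_ker (g - 1)
  have d5 := LinearMap.finrank_range_add_finrank_ker (h - 1)
  have d6 := LinearMap.finrank_range_add_finrank_ker (g * h - 1)
  change finrank F Ig + finrank F Fg = _ at d4
  change finrank F Ih + finrank F Fh = _ at d5
  change _ + finrank F Fgh = _ at d6
  obtain ⟨k, hk⟩ := key
  rw [Nat.even_iff]
  omega

/-! ### Symplectic and orthogonal groups in characteristic two -/

/-- The projective symplectic group: the symplectic group modulo its center. -/
abbrev ProjectiveSymplecticGroup (l F : Type*) [DecidableEq l] [Fintype l] [CommRing F] : Type _ :=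
  Matrix.symplecticGroup l F ⧸ Subgroup.center (Matrix.symplecticGroup l F)

/-- The standard alternating bilinear form `(x, y) ↦ xᵀ J y`, whose isometry group is the
symplectic group. -/
def symplecticForm (l F : Type*) [DecidableEq l] [Fintype l] [Field F] :
    LinearMap.BilinForm F (l ⊕ l → F) :=
  Matrix.toBilin' (Matrix.J l F)

/-- The quadratic form `Q` polarizes to the standard symplectic form:
`Q (x + y) - Q x - Q y = xᵀ J y`. In particular `Q` is nondegenerate. -/
def PolarizesToSymplectic {l F : Type*} [DecidableEq l] [Fintype l] [Field F]
    (Q : QuadraticForm F (l ⊕ l → F)) : Prop :=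
  ∀ x y, QuadraticMap.polar Q x y = symplecticForm l F x y

/-- `Q` has Witt index `k`: the largest dimension of a totally singular subspace is `k`. -/
def HasWittIndex {F V : Type*} [Field F] [AddCommGroup V] [Module F V] (Q : QuadraticForm F V)
    (k : ℕ) : Prop :=
  IsGreatest {d | ∃ W : Submodule F V, finrank F W = d ∧ ∀ w ∈ W, Q w = 0} k

/-- A quadratic form in `2m` variables, `m = |l|`, is of minus type if its Witt index is `m - 1`. -/
def IsMinusType {l F : Type*} [Fintype l] [Field F] (Q : QuadraticForm F (l ⊕ l → F)) : Prop :=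
  ∃ k, k + 1 = Fintype.card l ∧ HasWittIndex Q k

/-- A matrix preserving a quadratic form that polarizes to the symplectic form is symplectic, so
that the full isometry group of such a form lies in the symplectic group. -/
theorem mem_symplecticGroup_of_isometry {l F : Type*} [DecidableEq l] [Fintype l] [Field F]
    {Q : QuadraticForm F (l ⊕ l → F)} (hQ : PolarizesToSymplectic Q)
    {A : Matrix (l ⊕ l) (l ⊕ l) F} (hA : ∀ v, Q (A *ᵥ v) = Q v) :
    A ∈ Matrix.symplecticGroup l F := by
  rw [SymplecticGroup.mem_iff']
  apply Matrix.toBilin'.injective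
  refine LinearMap.ext fun x => LinearMap.ext fun y => ?_
  have h1 : symplecticForm l F (A *ᵥ x) (A *ᵥ y) = symplecticForm l F x y := by
    rw [← hQ, ← hQ, QuadraticMap.polar, QuadraticMap.polar, ← Matrix.mulVec_add, hA, hA, hA]
  have h2 := Matrix.toBilin'_comp (Matrix.J l F) A A
  rw [← h2]
  exact h1

/-- The general orthogonal group `GO(Q)` of a form `Q` polarizing to the symplectic form, as a
subgroup of the symplectic group. -/
def generalOrthogonal {l F : Type*} [DecidableEq l] [Fintype l] [Field F]
    (Q : QuadraticForm F (l ⊕ l → F)) : Subgroup (Matrix.symplecticGroup l F) where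
  carrier := {A | ∀ v, Q ((A : Matrix (l ⊕ l) (l ⊕ l) F) *ᵥ v) = Q v}
  mul_mem' {A B} hA hB v := by
    rw [Submonoid.coe_mul, ← Matrix.mulVec_mulVec, hA, hB]
  one_mem' v := by rw [Submonoid.coe_one, Matrix.one_mulVec]
  inv_mem' {A} hA v := by
    rw [← hA, Matrix.mulVec_mulVec, ← Submonoid.coe_mul, mul_inv_cancel, Submonoid.coe_one,
      Matrix.one_mulVec]

/-- On `GO(Q)` the parity of `rank (A - 1)` is multiplicative. -/
theorem even_rank_mul_sub_one_of_mem {l F : Type*} [DecidableEq l] [Fintype l] [Field F]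
    [CharP F 2] {Q : QuadraticForm F (l ⊕ l → F)} (hQ : PolarizesToSymplectic Q)
    {A B : Matrix.symplecticGroup l F} (hA : A ∈ generalOrthogonal Q)
    (hB : B ∈ generalOrthogonal Q) :
    Even (((A * B : Matrix.symplecticGroup l F) - 1 : Matrix (l ⊕ l) (l ⊕ l) F).rank +
      (A - 1 : Matrix (l ⊕ l) (l ⊕ l) F).rank + (B - 1 : Matrix (l ⊕ l) (l ⊕ l) F).rank) := by
  have hadd : ∀ x y, Q (x + y) = Q x + Q y + symplecticForm l F x y := by
    intro x y
    rw [← hQ, QuadraticMap.polar]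
    ring
  have halt : (symplecticForm l F).IsAlt := by
    intro x
    have h1 := hadd x x
    have h2 : x + x = (2 : F) • x := (two_smul F x).symm
    rw [h2, QuadraticMap.map_smul, CharTwo.two_eq_zero, ← two_mul, CharTwo.two_eq_zero] at h1
    simpa using h1.symm
  have hnd : (symplecticForm l F).Nondegenerate := by
    refine LinearMap.BilinForm.nondegenerate_toBilin'_of_det_ne_zero' _ ?_
    exact (Matrix.isUnit_det_J l F).ne_zero
  have key := even_rank_mul_sub_one Q (symplecticForm l F) halt hnd hadd
    (Matrix.toLin' (A : Matrix (l ⊕ l) (l ⊕ l) F)) (Matrix.toLin' (B : Matrix (l ⊕ l) (l ⊕ l) F))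
    (fun v => by rw [Matrix.toLin'_apply]; exact hA v)
    (fun v => by rw [Matrix.toLin'_apply]; exact hB v)
  have hr : ∀ M : Matrix (l ⊕ l) (l ⊕ l) F,
      (M - 1).rank = finrank F (LinearMap.range (Matrix.toLin' M - 1)) := by
    intro M
    rw [Matrix.rank, ← Matrix.toLin'_apply', map_sub, Matrix.toLin'_one]
    rfl
  rw [hr, hr, hr, Submonoid.coe_mul, Matrix.toLin'_mul]
  exact key

/-- The group `Ω(Q)` in characteristic two: the kernel of the Dickson invariant (or
quasideterminant) `A ↦ rank (A - 1) mod 2` on `GO(Q)`. -/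
def omegaGroup {l F : Type*} [DecidableEq l] [Fintype l] [Field F] [CharP F 2]
    (Q : QuadraticForm F (l ⊕ l → F)) (hQ : PolarizesToSymplectic Q) :
    Subgroup (Matrix.symplecticGroup l F) where
  carrier := {A | A ∈ generalOrthogonal Q ∧ Even (A - 1 : Matrix (l ⊕ l) (l ⊕ l) F).rank}
  mul_mem' {A B} hA hB := by
    refine ⟨mul_mem hA.1 hB.1, ?_⟩
    have h := even_rank_mul_sub_one_of_mem hQ hA.1 hB.1
    have h1 := hA.2
    have h2 := hB.2
    rw [Nat.even_iff] at *
    omega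
  one_mem' := ⟨one_mem _, by simp⟩
  inv_mem' {A} hA := by
    refine ⟨inv_mem hA.1, ?_⟩
    have h := even_rank_mul_sub_one_of_mem hQ (inv_mem hA.1) hA.1
    have h1 := hA.2
    rw [inv_mul_cancel, Submonoid.coe_one, sub_self, Matrix.rank_zero] at h
    rw [Nat.even_iff] at *
    omega

/-! ### The standard symplectic form -/

section Form

variable {l F : Type*} [DecidableEq l] [Fintype l] [Field F]

/-! Write `B` for the symplectic form. In characteristic two the centre of `Sp` is trivial, so `PSp`
may be replaced by `Sp`. The minus-type forms polarizing to `B` form a single orbit under `Sp`, so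
their groups `Ω` are all conjugate. It therefore suffices to find, for every prime power that is the
order of an element of `Sp`, an element whose order is a multiple of it in `Ω(Q')` for some minus
form `Q'`, which may vary with the prime power.

Forms. The forms polarizing to `B` are the shifts `Q + B(·, u)²` of any one of them. A shift of the
hyperbolic form `H = ∑ xᵢ yᵢ` by `u` has a totally singular subspace of dimension `m` exactly when
`H u` lies in the index-two subgroup `{d² + d}` (`HasLagrangian.formShift_iff`). This yields the
existence of minus forms, their equivalence, and their number `q^m (q^m - 1) / 2`.

Odd primes (`prime_pow_dvd_exponent_omegaGroup`). Isometries of odd order lie in `Ω` automatically.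
An element of order `p^k` in `Sp`, with `k > 0`, has an eigenvalue of that order, which forces `p^k
∣ q^(2i) - 1` for some `0 < i ≤ m`. If `i < m`, an element of `SL₂(q^i)` gives a symplectic element
of order `p^k` fixing two nonorthogonal vectors, and an invariant form can be shifted along a fixed
vector until it has minus type. If `i = m` and `p ∤ q^m - 1`, then `p` does not divide the number of
minus forms, so the given element fixes one of them. If `i = m` and `p ∣ q^m - 1`, then already `p^k
∣ q^m - 1`; as `m` is even this is the case `i = m / 2`.

The prime two (`exists_mem_omegaGroup_orderOf_two_pow`). Orders of 2-elements divide `2^a`, the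
least power of two that is at least `2m`. Evenness of `m` turns `2^(a-1) < 2m` into `2^(a-2) + 2 ≤
m`. On `2^(a-2)` hyperbolic pairs there is a signed cycle of order `2^(a-1)`; a Siegel
transformation using one further pair doubles the order; another pair remains fixed, and it supplies
both the minus type and a reflection correcting the Dickson invariant. -/

theorem symplecticForm_apply (x y : l ⊕ l → F) :
    symplecticForm l F x y =
      ∑ i, x (.inr i) * y (.inl i) - ∑ i, x (.inl i) * y (.inr i) := by
  rw [symplecticForm, Matrix.toBilin'_apply', Matrix.J, Matrix.fromBlocks_mulVec,
    dotProduct, Fintype.sum_sum_type]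
  simp [Matrix.neg_mulVec, sub_eq_add_neg, add_comm]

theorem symplecticForm_isAlt : (symplecticForm l F).IsAlt := by
  intro x
  rw [symplecticForm_apply, sub_eq_zero]
  exact Finset.sum_congr rfl fun i _ => mul_comm _ _

theorem symplecticForm_nondegenerate : (symplecticForm l F).Nondegenerate :=
  LinearMap.BilinForm.nondegenerate_toBilin'_of_det_ne_zero' _ (Matrix.isUnit_det_J l F).ne_zero

theorem mem_symplecticGroup_iff_symplecticForm {A : Matrix (l ⊕ l) (l ⊕ l) F} :
    A ∈ symplecticGroup l F ↔
      ∀ x y, symplecticForm l F (A *ᵥ x) (A *ᵥ y) = symplecticForm l F x y := by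
  have h2 := Matrix.toBilin'_comp (Matrix.J l F) A A
  rw [SymplecticGroup.mem_iff']
  constructor
  · intro h x y
    rw [h] at h2
    exact LinearMap.congr_fun₂ h2 x y
  · intro h
    apply Matrix.toBilin'.injective
    rw [← h2]
    exact LinearMap.ext₂ h

theorem symplecticForm_mulVec (A : symplecticGroup l F) (x y : l ⊕ l → F) :
    symplecticForm l F (A.1 *ᵥ x) (A.1 *ᵥ y) = symplecticForm l F x y :=
  mem_symplecticGroup_iff_symplecticForm.1 A.2 x y

theorem symplecticForm_mulVec_of_fixed {A : symplecticGroup l F} {u : l ⊕ l → F}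
    (hu : A.1 *ᵥ u = u) (v : l ⊕ l → F) :
    symplecticForm l F (A.1 *ᵥ v) u = symplecticForm l F v u := by
  nth_rewrite 1 [← hu]
  rw [symplecticForm_mulVec]

theorem symplecticForm_comm [CharP F 2] (x y : l ⊕ l → F) :
    symplecticForm l F x y = symplecticForm l F y x := by
  rw [← symplecticForm_isAlt.neg_eq, CharTwo.neg_eq]

theorem eq_zero_of_symplecticForm {x : l ⊕ l → F} (h : ∀ y, symplecticForm l F y x = 0) : x = 0 :=
  symplecticForm_nondegenerate.2 x h

theorem mulVec_inv_mulVec (A : symplecticGroup l F) (x : l ⊕ l → F) :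
    A.1 *ᵥ ((A⁻¹).1 *ᵥ x) = x := by
  rw [Matrix.mulVec_mulVec, ← Submonoid.coe_mul, mul_inv_cancel, Submonoid.coe_one,
    Matrix.one_mulVec]

/-! ### Quadratic forms polarizing to the symplectic form -/

theorem PolarizesToSymplectic.map_add {Q : QuadraticForm F (l ⊕ l → F)}
    (hQ : PolarizesToSymplectic Q) (x y : l ⊕ l → F) :
    Q (x + y) = Q x + Q y + symplecticForm l F x y := by
  rw [← hQ, QuadraticMap.polar]
  ring

/-- The quadratic form `Q + B(·, u)²`, where `B` is the symplectic form. -/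
def formShift (Q : QuadraticForm F (l ⊕ l → F)) (u : l ⊕ l → F) : QuadraticForm F (l ⊕ l → F) :=
  Q + QuadraticMap.linMulLin ((symplecticForm l F).flip u) ((symplecticForm l F).flip u)

theorem formShift_apply (Q : QuadraticForm F (l ⊕ l → F)) (u v : l ⊕ l → F) :
    formShift Q u v = Q v + symplecticForm l F v u ^ 2 := by
  simp [formShift, sq]

/-- The quadratic form `Q ∘ A`. -/
def formComp (Q : QuadraticForm F (l ⊕ l → F)) (A : symplecticGroup l F) :
    QuadraticForm F (l ⊕ l → F) :=
  Q.comp (Matrix.mulVecLin A.1)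

@[simp]
theorem formComp_apply (Q : QuadraticForm F (l ⊕ l → F)) (A : symplecticGroup l F)
    (v : l ⊕ l → F) : formComp Q A v = Q (A.1 *ᵥ v) := rfl

theorem formComp_mul (Q : QuadraticForm F (l ⊕ l → F)) (A B : symplecticGroup l F) :
    formComp Q (A * B) = formComp (formComp Q A) B := by
  ext v
  simp [Matrix.mulVec_mulVec]

theorem formComp_one (Q : QuadraticForm F (l ⊕ l → F)) :
    formComp Q (1 : symplecticGroup l F) = Q := by
  ext v
  simp

theorem PolarizesToSymplectic.formComp {Q : QuadraticForm F (l ⊕ l → F)}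
    (hQ : PolarizesToSymplectic Q) (A : symplecticGroup l F) :
    PolarizesToSymplectic (formComp Q A) := by
  intro x y
  rw [← symplecticForm_mulVec A, ← hQ, QuadraticMap.polar, QuadraticMap.polar, formComp_apply,
    formComp_apply, formComp_apply, Matrix.mulVec_add]

variable [CharP F 2]

theorem PolarizesToSymplectic.formShift {Q : QuadraticForm F (l ⊕ l → F)}
    (hQ : PolarizesToSymplectic Q) (u : l ⊕ l → F) : PolarizesToSymplectic (formShift Q u) := by
  intro x y
  rw [QuadraticMap.polar, formShift_apply, formShift_apply, formShift_apply, hQ.map_add,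
    LinearMap.map_add, LinearMap.add_apply]
  linear_combination symplecticForm l F x u * symplecticForm l F y u * (CharTwo.two_eq_zero (R := F))

theorem formShift_formShift (Q : QuadraticForm F (l ⊕ l → F)) (u v : l ⊕ l → F) :
    formShift (formShift Q u) v = formShift Q (u + v) := by
  ext x
  rw [formShift_apply, formShift_apply, formShift_apply, LinearMap.map_add]
  linear_combination -symplecticForm l F x u * symplecticForm l F x v *
    (CharTwo.two_eq_zero (R := F))

theorem formShift_injective (Q : QuadraticForm F (l ⊕ l → F)) :
    Function.Injective (formShift Q) := by
  intro u v h
  rw [← sub_eq_zero]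
  apply eq_zero_of_symplecticForm
  intro y
  have := QuadraticMap.congr_fun h y
  rw [formShift_apply, formShift_apply, add_right_inj, CharTwo.sq_inj] at this
  rw [map_sub, this, sub_self]

/-- A linear functional is of the form `B(·, u)`. -/
theorem exists_symplecticForm_eq (f : (l ⊕ l → F) →ₗ[F] F) :
    ∃ u, ∀ v, f v = symplecticForm l F v u := by
  refine ⟨(LinearMap.BilinForm.toDual _ symplecticForm_nondegenerate).symm f, fun v => ?_⟩
  rw [symplecticForm_comm, LinearMap.BilinForm.apply_toDual_symm_apply]

/-- The difference of two forms with the same polar form is additive and scales by squares. Over a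
finite field of characteristic two its square root is a linear functional, hence of the form `B(·,
u)`. -/
theorem exists_formShift_eq [Finite F] {Q Q' : QuadraticForm F (l ⊕ l → F)}
    (hQ : PolarizesToSymplectic Q) (hQ' : PolarizesToSymplectic Q') :
    ∃ u, Q' = formShift Q u := by
  have key : ∀ x y, (Q' - Q) (x + y) = (Q' - Q) x + (Q' - Q) y := by
    intro x y
    rw [_root_.sub_apply, _root_.sub_apply, _root_.sub_apply, hQ.map_add,
      hQ'.map_add]
    ring
  let σ := (frobeniusEquiv F 2).symm
  have hσ : ∀ a : F, σ (a ^ 2) = a := fun a => by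
    rw [RingEquiv.symm_apply_eq, frobeniusEquiv_apply, frobenius_def]
  have hσ' : ∀ a : F, σ a ^ 2 = a := fun a => by
    rw [← frobenius_def, ← frobeniusEquiv_apply, RingEquiv.apply_symm_apply]
  obtain ⟨u, hu⟩ := exists_symplecticForm_eq (l := l)
    { toFun := fun v => σ ((Q' - Q) v)
      map_add' := fun x y => by rw [key, map_add]
      map_smul' := fun c x => by
        rw [QuadraticMap.map_smul, smul_eq_mul, ← sq, map_mul, hσ, RingHom.id_apply, smul_eq_mul] }
  refine ⟨u, QuadraticMap.ext fun v => ?_⟩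
  rw [formShift_apply, ← hu]
  change _ = Q v + σ ((Q' - Q) v) ^ 2
  rw [hσ', _root_.sub_apply]
  ring

/-! ### Transvections -/

/-- The symplectic transvection `v ↦ v + c B(v, u) u`. -/
def symplecticTransvection (c : F) (u : l ⊕ l → F) : symplecticGroup l F :=
  ⟨LinearMap.toMatrix' (LinearMap.id + ((symplecticForm l F).flip u).smulRight (c • u)), by
    rw [mem_symplecticGroup_iff_symplecticForm]
    intro x y
    rw [← Matrix.toLin'_apply, ← Matrix.toLin'_apply, Matrix.toLin'_toMatrix']
    simp only [LinearMap.add_apply, LinearMap.id_apply,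
      LinearMap.smulRight_apply, map_add, map_smul, LinearMap.smul_apply, smul_eq_mul,
      LinearMap.BilinForm.flip_apply, symplecticForm_isAlt.self_eq_zero, symplecticForm_comm u y]
    linear_combination c * symplecticForm l F x u * symplecticForm l F y u *
      (CharTwo.two_eq_zero (R := F))⟩

theorem symplecticTransvection_mulVec (c : F) (u v : l ⊕ l → F) :
    (symplecticTransvection c u).1 *ᵥ v = v + (c * symplecticForm l F v u) • u := by
  rw [symplecticTransvection, ← Matrix.toLin'_apply, Matrix.toLin'_toMatrix']
  simp [smul_smul, mul_comm]

theorem formComp_symplecticTransvection_apply {Q : QuadraticForm F (l ⊕ l → F)}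
    (hQ : PolarizesToSymplectic Q) (c : F) (u v : l ⊕ l → F) :
    formComp Q (symplecticTransvection c u) v =
      Q v + (c + c ^ 2 * Q u) * symplecticForm l F v u ^ 2 := by
  rw [formComp_apply, symplecticTransvection_mulVec, hQ.map_add, QuadraticMap.map_smul, map_smul,
    smul_eq_mul, smul_eq_mul]
  ring

/-- The transvection with parameter `c` along `u` adds `(c + c² Q u) B(·, u)²` to `Q`. Making the
coefficient equal to `1` is the equation `t² + t = Q u` in `t = c Q u`, solved by `t = d`; for
singular `u` one takes `c = 1`. -/
theorem exists_formComp_eq_formShift {Q : QuadraticForm F (l ⊕ l → F)}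
    (hQ : PolarizesToSymplectic Q) {u : l ⊕ l → F} {d : F} (hd : Q u = d ^ 2 + d) :
    ∃ S, formComp Q S = formShift Q u := by
  obtain ⟨c, hc⟩ : ∃ c : F, c + c ^ 2 * Q u = 1 := by
    by_cases h : Q u = 0
    · exact ⟨1, by rw [h]; ring⟩
    · refine ⟨d / Q u, ?_⟩
      field_simp
      rw [hd]
      ring
  refine ⟨symplecticTransvection c u, QuadraticMap.ext fun v => ?_⟩
  rw [formComp_symplecticTransvection_apply hQ, hc, one_mul, formShift_apply]

/-- A central `z` commutes with the transvection along `u`, so it maps `u` to a multiple `a • u`.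
Invariance of `B` gives `a² = 1`, and in characteristic two this means `a = 1`. -/
theorem center_symplecticGroup_eq_bot : Subgroup.center (symplecticGroup l F) = ⊥ := by
  rw [eq_bot_iff]
  intro z hz
  rw [Subgroup.mem_center_iff] at hz
  rw [Subgroup.mem_bot]
  refine Subtype.ext (Matrix.ext_of_mulVec_single fun i => ?_)
  rw [Submonoid.coe_one, Matrix.one_mulVec]
  generalize (Pi.single i 1 : l ⊕ l → F) = u
  by_cases hu : u = 0
  · rw [hu, Matrix.mulVec_zero]
  have key : ∀ v, symplecticForm l F v u • z.1 *ᵥ u = symplecticForm l F (z.1 *ᵥ v) u • u := by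
    intro v
    have h := congrArg (fun A : symplecticGroup l F => A.1 *ᵥ v) (hz (symplecticTransvection 1 u))
    simp only [Submonoid.coe_mul, ← Matrix.mulVec_mulVec, symplecticTransvection_mulVec,
      Matrix.mulVec_add, Matrix.mulVec_smul, one_mul, add_right_inj] at h
    exact h.symm
  obtain ⟨v, hv⟩ : ∃ v, symplecticForm l F v u ≠ 0 := by
    by_contra! h
    exact hu (eq_zero_of_symplecticForm h)
  set a := symplecticForm l F (z.1 *ᵥ v) u / symplecticForm l F v u with ha
  have hz1 : z.1 *ᵥ u = a • u := by
    rw [ha, div_eq_inv_mul, ← smul_smul, ← key, smul_smul, inv_mul_cancel₀ hv, one_smul]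
  have h1 : symplecticForm l F (z.1 *ᵥ v) u = a * symplecticForm l F v u := by
    rw [ha, div_mul_cancel₀ _ hv]
  have h2 := symplecticForm_mulVec z v u
  rw [hz1, map_smul, smul_eq_mul, h1, ← mul_assoc, ← sq] at h2
  have h3 : a ^ 2 = 1 ^ 2 := by
    rw [one_pow]
    exact mul_right_cancel₀ hv (by rw [h2, one_mul])
  rw [CharTwo.sq_inj] at h3
  rw [hz1, h3, one_smul]

end Form

/-! ### The Artin–Schreier map in characteristic two -/

section ArtinSchreier

variable {F : Type*} [Field F] [CharP F 2]

variable (F) in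
/-- The additive map `d ↦ d ^ 2 + d` in characteristic two. -/
def artinSchreier : F →+ F where
  toFun d := d ^ 2 + d
  map_zero' := by simp
  map_add' a b := by
    linear_combination a * b * (CharTwo.two_eq_zero (R := F))

@[simp]
theorem artinSchreier_apply (d : F) : artinSchreier F d = d ^ 2 + d := rfl

theorem card_ker_artinSchreier : Nat.card (artinSchreier F).ker = 2 := by
  have h : ((artinSchreier F).ker : Set F) = {0, 1} := by
    ext d
    rw [SetLike.mem_coe, AddMonoidHom.mem_ker, artinSchreier_apply, sq, ← mul_add_one, mul_eq_zero,
      CharTwo.add_eq_zero]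
    rfl
  change Nat.card ((artinSchreier F).ker : Set F) = 2
  rw [h, Nat.card_coe_set_eq, Set.ncard_pair zero_ne_one]

variable [Finite F]

theorem index_range_artinSchreier : (artinSchreier F).range.index = 2 := by
  have h1 := (artinSchreier F).ker.card_mul_index
  have h2 := (artinSchreier F).range.card_mul_index
  rw [AddSubgroup.index_ker, card_ker_artinSchreier, ← h2, mul_comm] at h1
  exact (Nat.eq_of_mul_eq_mul_left Nat.card_pos h1).symm

theorem exists_notMem_range_artinSchreier : ∃ b : F, b ∉ (artinSchreier F).range := by
  by_contra! h
  have h1 := index_range_artinSchreier (F := F)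
  rw [(AddSubgroup.eq_top_iff' _).2 h, AddSubgroup.index_top] at h1
  omega

theorem add_mem_range_artinSchreier_iff {a b : F} :
    a + b ∈ (artinSchreier F).range ↔
      (a ∈ (artinSchreier F).range ↔ b ∈ (artinSchreier F).range) :=
  AddSubgroup.add_mem_iff_of_index_two index_range_artinSchreier

omit [Finite F] in
theorem sq_add_self_mem_range_artinSchreier (a : F) : a ^ 2 + a ∈ (artinSchreier F).range := ⟨a, rfl⟩

theorem sq_mem_range_artinSchreier_iff {a : F} :
    a ^ 2 ∈ (artinSchreier F).range ↔ a ∈ (artinSchreier F).range :=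
  add_mem_range_artinSchreier_iff.1 (sq_add_self_mem_range_artinSchreier a)

end ArtinSchreier

/-! ### The two types of forms -/

section Types

variable {l F : Type*} [DecidableEq l] [Fintype l] [Field F]

/-- `Q` vanishes on a subspace of half the dimension. -/
def HasLagrangian (Q : QuadraticForm F (l ⊕ l → F)) : Prop :=
  ∃ W : Submodule F (l ⊕ l → F), finrank F W = Fintype.card l ∧ ∀ w ∈ W, Q w = 0

theorem symplecticForm_eq_zero_of_singular {Q : QuadraticForm F (l ⊕ l → F)}
    (hQ : PolarizesToSymplectic Q) {W : Submodule F (l ⊕ l → F)} (hW : ∀ w ∈ W, Q w = 0)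
    {x y : l ⊕ l → F} (hx : x ∈ W) (hy : y ∈ W) : symplecticForm l F x y = 0 := by
  have := hQ.map_add x y
  rw [hW _ hx, hW _ hy, hW _ (W.add_mem hx hy)] at this
  simpa using this.symm

theorem finrank_orthogonal_symplecticForm (W : Submodule F (l ⊕ l → F)) :
    finrank F ((symplecticForm l F).orthogonal W) + finrank F W = 2 * Fintype.card l := by
  have h1 := LinearMap.BilinForm.finrank_orthogonal symplecticForm_nondegenerate W
  have h2 := Submodule.finrank_le W
  have h3 : finrank F (l ⊕ l → F) = 2 * Fintype.card l := by simp [two_mul]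
  omega

theorem finrank_le_of_singular {Q : QuadraticForm F (l ⊕ l → F)}
    (hQ : PolarizesToSymplectic Q) {W : Submodule F (l ⊕ l → F)} (hW : ∀ w ∈ W, Q w = 0) :
    finrank F W ≤ Fintype.card l := by
  have h1 := finrank_orthogonal_symplecticForm W
  have h2 : W ≤ (symplecticForm l F).orthogonal W := fun x hx y hy =>
    symplecticForm_eq_zero_of_singular hQ hW hy hx
  have h3 := Submodule.finrank_mono h2
  omega

theorem orthogonal_eq_of_singular {Q : QuadraticForm F (l ⊕ l → F)}
    (hQ : PolarizesToSymplectic Q) {W : Submodule F (l ⊕ l → F)} (hW : ∀ w ∈ W, Q w = 0)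
    (hd : finrank F W = Fintype.card l) : (symplecticForm l F).orthogonal W = W := by
  have h1 := finrank_orthogonal_symplecticForm W
  have h2 : W ≤ (symplecticForm l F).orthogonal W := fun x hx y hy =>
    symplecticForm_eq_zero_of_singular hQ hW hy hx
  exact (Submodule.eq_of_le_of_finrank_le h2 (by omega)).symm

theorem exists_singular_formComp {Q : QuadraticForm F (l ⊕ l → F)} {d : ℕ}
    (h : ∃ W : Submodule F (l ⊕ l → F), finrank F W = d ∧ ∀ w ∈ W, Q w = 0)
    (A : symplecticGroup l F) :
    ∃ W : Submodule F (l ⊕ l → F), finrank F W = d ∧ ∀ w ∈ W, formComp Q A w = 0 := by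
  obtain ⟨W, hd, hW⟩ := h
  have hinj : Function.Injective (Matrix.mulVecLin (A⁻¹).1) :=
    Function.LeftInverse.injective (g := Matrix.mulVecLin A.1) (mulVec_inv_mulVec A)
  refine ⟨W.map (Matrix.mulVecLin (A⁻¹).1), ?_, ?_⟩
  · rw [← hd]
    exact (Submodule.equivMapOfInjective _ hinj W).finrank_eq.symm
  · rintro _ ⟨w, hw, rfl⟩
    rw [formComp_apply, Matrix.mulVecLin_apply, mulVec_inv_mulVec, hW w hw]

theorem HasLagrangian.formComp {Q : QuadraticForm F (l ⊕ l → F)} (h : HasLagrangian Q)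
    (A : symplecticGroup l F) : HasLagrangian (formComp Q A) :=
  exists_singular_formComp h A

variable [CharP F 2]

/-- Let `E` and `W` be Lagrangians of `Q` and of its shift. Both forms vanish on `E ∩ W`, so `u` is
orthogonal to `E ∩ W`, that is, `u = e + w` lies in `E + W`. Vanishing of the shifted form at `w`
reads `Q w = B(e, w)²`, whence `Q u = B(e, w)² + B(e, w)`. -/
theorem HasLagrangian.mem_range_artinSchreier {Q : QuadraticForm F (l ⊕ l → F)}
    (hQ : PolarizesToSymplectic Q) (h : HasLagrangian Q) {u : l ⊕ l → F}
    (hu : HasLagrangian (formShift Q u)) : Q u ∈ (artinSchreier F).range := by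
  obtain ⟨E, hdE, hE⟩ := h
  obtain ⟨W, hdW, hW⟩ := hu
  have hE' := orthogonal_eq_of_singular hQ hE hdE
  have hW' := orthogonal_eq_of_singular (hQ.formShift u) hW hdW
  have hmem : u ∈ E ⊔ W := by
    rw [← LinearMap.BilinForm.orthogonal_orthogonal symplecticForm_nondegenerate
      symplecticForm_isAlt.isRefl (E ⊔ W)]
    intro x hx
    have hxE : x ∈ E := by
      rw [← hE']
      exact LinearMap.BilinForm.orthogonal_le le_sup_left hx
    have hxW : x ∈ W := by
      rw [← hW']
      exact LinearMap.BilinForm.orthogonal_le le_sup_right hx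
    have := hW x hxW
    rw [formShift_apply, hE x hxE, zero_add] at this
    exact pow_eq_zero_iff two_ne_zero |>.1 this
  obtain ⟨e, he, w, hw, rfl⟩ := Submodule.mem_sup.1 hmem
  refine ⟨symplecticForm l F e w, ?_⟩
  have h1 := hW w hw
  rw [formShift_apply, map_add, symplecticForm_isAlt.self_eq_zero, add_zero,
    CharTwo.add_eq_zero] at h1
  rw [hQ.map_add, hE e he, h1, artinSchreier_apply, symplecticForm_comm w e]
  ring

/-- Among the shifts of a form with a Lagrangian, those with a Lagrangian are given by an
Artin–Schreier condition. -/
theorem HasLagrangian.formShift_iff {Q : QuadraticForm F (l ⊕ l → F)}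
    (hQ : PolarizesToSymplectic Q) (h : HasLagrangian Q) {u : l ⊕ l → F} :
    HasLagrangian (formShift Q u) ↔ Q u ∈ (artinSchreier F).range := by
  refine ⟨h.mem_range_artinSchreier hQ, ?_⟩
  rintro ⟨d, hd⟩
  obtain ⟨S, hS⟩ := exists_formComp_eq_formShift hQ hd.symm
  rw [← hS]
  exact h.formComp S

/-- The quadratic form `∑ xᵢ yᵢ`. -/
def hyperbolicForm (l F : Type*) [DecidableEq l] [Fintype l] [Field F] :
    QuadraticForm F (l ⊕ l → F) :=
  ∑ i, QuadraticMap.linMulLin (LinearMap.proj (.inl i)) (LinearMap.proj (.inr i))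

omit [CharP F 2] in
theorem hyperbolicForm_apply (v : l ⊕ l → F) :
    hyperbolicForm l F v = ∑ i, v (.inl i) * v (.inr i) := by
  simp [hyperbolicForm]

variable (l F) in
theorem polarizes_hyperbolicForm : PolarizesToSymplectic (hyperbolicForm l F) := by
  intro x y
  rw [QuadraticMap.polar, hyperbolicForm_apply, hyperbolicForm_apply, hyperbolicForm_apply,
    symplecticForm_apply, ← Finset.sum_sub_distrib, ← Finset.sum_sub_distrib,
    ← Finset.sum_sub_distrib]
  refine Finset.sum_congr rfl fun i _ => ?_
  simp only [Pi.add_apply]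
  linear_combination (x (.inl i) * y (.inr i)) * (CharTwo.two_eq_zero (R := F))

omit [DecidableEq l] [CharP F 2] in
/-- The subspace of vectors whose second half vanishes and whose first half vanishes on `s`. -/
theorem exists_submodule_inl (s : Finset l) : ∃ W : Submodule F (l ⊕ l → F),
    finrank F W + s.card = Fintype.card l ∧
      ∀ w ∈ W, (∀ i, w (.inr i) = 0) ∧ ∀ i ∈ s, w (.inl i) = 0 := by
  classical
  let f : ({i // i ∉ s} → F) →ₗ[F] (l ⊕ l → F) :=
    { toFun := fun w => Sum.elim (fun i => if h : i ∉ s then w ⟨i, h⟩ else 0) 0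
      map_add' := fun x y => by
        ext (i | i) <;> by_cases h : i ∈ s <;> simp [h]
      map_smul' := fun c x => by
        ext (i | i) <;> by_cases h : i ∈ s <;> simp [h] }
  have hf : Function.Injective f := by
    intro x y h
    ext ⟨i, hi⟩
    have := congrFun h (.inl i)
    simpa [f, hi] using this
  refine ⟨LinearMap.range f, ?_, ?_⟩
  · rw [LinearMap.finrank_range_of_inj hf, finrank_fintype_fun_eq_card, Fintype.card_subtype_compl,
      Fintype.card_coe]
    exact Nat.sub_add_cancel (Finset.card_le_univ s)
  · rintro _ ⟨x, rfl⟩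
    refine ⟨fun i => rfl, fun i hi => ?_⟩
    simp [f, hi]

omit [CharP F 2] in
theorem hasLagrangian_hyperbolicForm : HasLagrangian (hyperbolicForm l F) := by
  obtain ⟨W, hd, hW⟩ := exists_submodule_inl (F := F) (∅ : Finset l)
  refine ⟨W, by simpa using hd, fun w hw => ?_⟩
  rw [hyperbolicForm_apply]
  exact Finset.sum_eq_zero fun i _ => by rw [(hW w hw).1, mul_zero]

/-- The vector with `b` at the two coordinates of index `k`. -/
def diagVec (k : l) (b : F) : l ⊕ l → F := Pi.single (.inl k) b + Pi.single (.inr k) b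

omit [CharP F 2] in
theorem hyperbolicForm_diagVec (k : l) (b : F) : hyperbolicForm l F (diagVec k b) = b ^ 2 := by
  rw [hyperbolicForm_apply, Finset.sum_eq_single k]
  · simp [diagVec, sq]
  · intro i _ hi
    simp [diagVec, hi]
  · simp

theorem symplecticForm_diagVec (k : l) (b : F) (v : l ⊕ l → F) :
    symplecticForm l F v (diagVec k b) = b * (v (.inl k) + v (.inr k)) := by
  rw [symplecticForm_apply, Finset.sum_eq_single k, Finset.sum_eq_single k]
  · simp [diagVec]
    linear_combination (-v (.inl k) * b) * (CharTwo.two_eq_zero (R := F))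
  · intro i _ hi
    simp [diagVec, hi]
  · simp
  · intro i _ hi
    simp [diagVec, hi]
  · simp

variable [Finite F]

/-- The standard Lagrangian of the hyperbolic form, cut down by the vanishing of its coordinate `k`,
stays singular after the shift. A larger singular subspace would be a Lagrangian and would put `b²`,
hence `b`, in the Artin–Schreier image. -/
theorem isMinusType_formShift_hyperbolicForm (k : l) {b : F} (hb : b ∉ (artinSchreier F).range) :
    IsMinusType (formShift (hyperbolicForm l F) (diagVec k b)) := by
  have hcard : 0 < Fintype.card l := Fintype.card_pos_iff.2 ⟨k⟩
  refine ⟨Fintype.card l - 1, by omega, ?_, ?_⟩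
  · obtain ⟨W, hd, hW⟩ := exists_submodule_inl (F := F) {k}
    rw [Finset.card_singleton] at hd
    refine ⟨W, by omega, fun w hw => ?_⟩
    rw [formShift_apply, hyperbolicForm_apply, symplecticForm_diagVec, (hW w hw).1,
      (hW w hw).2 k (by simp), Finset.sum_eq_zero fun i _ => by rw [(hW w hw).1, mul_zero]]
    simp
  · rintro d ⟨W, rfl, hW⟩
    have h1 := finrank_le_of_singular ((polarizes_hyperbolicForm l F).formShift _) hW
    by_contra! h2
    have h3 : HasLagrangian (formShift (hyperbolicForm l F) (diagVec k b)) :=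
      ⟨W, by omega, hW⟩
    rw [hasLagrangian_hyperbolicForm.formShift_iff (polarizes_hyperbolicForm l F),
      hyperbolicForm_diagVec, sq_mem_range_artinSchreier_iff] at h3
    exact hb h3

omit [Finite F] [CharP F 2] [DecidableEq l] in
theorem IsMinusType.not_hasLagrangian {Q : QuadraticForm F (l ⊕ l → F)} (h : IsMinusType Q) :
    ¬ HasLagrangian Q := by
  obtain ⟨k, hk, h⟩ := h
  intro hL
  have := h.2 hL
  omega

/-- Two forms without a Lagrangian are equivalent. -/
theorem exists_formComp_eq_of_not_hasLagrangian {Q Q' : QuadraticForm F (l ⊕ l → F)}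
    (hQ : PolarizesToSymplectic Q) (hQ' : PolarizesToSymplectic Q') (h : ¬ HasLagrangian Q)
    (h' : ¬ HasLagrangian Q') : ∃ S, Q' = formComp Q S := by
  have h0 := polarizes_hyperbolicForm l F
  obtain ⟨u, rfl⟩ := exists_formShift_eq h0 hQ
  obtain ⟨u', rfl⟩ := exists_formShift_eq h0 hQ'
  rw [hasLagrangian_hyperbolicForm.formShift_iff h0] at h h'
  -- The values at `u` and `u'` both lie in the nontrivial coset of an index-two subgroup, so their
  -- sum lies in the subgroup; the remaining terms are the Artin–Schreier image of `B(u, u')`.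
  -- Shifting by `u + u'` turns the form of `u` into that of `u'`.
  have h1 : formShift (hyperbolicForm l F) u (u + u') ∈ (artinSchreier F).range := by
    have h2 : formShift (hyperbolicForm l F) u (u + u') =
        (hyperbolicForm l F u + hyperbolicForm l F u') +
          (symplecticForm l F u u' ^ 2 + symplecticForm l F u u') := by
      rw [formShift_apply, h0.map_add, map_add, LinearMap.add_apply,
        symplecticForm_isAlt.self_eq_zero, symplecticForm_comm u' u]
      ring
    rw [h2]
    refine add_mem (add_mem_range_artinSchreier_iff.2 ?_) (sq_add_self_mem_range_artinSchreier _)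
    simp only [h, h']
  obtain ⟨d, hd⟩ := h1
  obtain ⟨S, hS⟩ := exists_formComp_eq_formShift hQ hd.symm
  refine ⟨S, ?_⟩
  rw [hS, formShift_formShift]
  congr 1
  have : u + (u + u') = u' + (2 : F) • u := by rw [two_smul]; abel
  rw [this, CharTwo.two_eq_zero, zero_smul, add_zero]

omit [DecidableEq l] [CharP F 2] [Finite F] in
theorem IsMinusType.nonempty {Q : QuadraticForm F (l ⊕ l → F)} (h : IsMinusType Q) :
    Nonempty l := by
  obtain ⟨k, hk, -⟩ := h
  exact Fintype.card_pos_iff.1 (by omega)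

variable (F) in
theorem exists_isMinusType [Nonempty l] :
    ∃ Q : QuadraticForm F (l ⊕ l → F), PolarizesToSymplectic Q ∧ IsMinusType Q := by
  obtain ⟨b, hb⟩ := exists_notMem_range_artinSchreier (F := F)
  exact ⟨_, (polarizes_hyperbolicForm l F).formShift _,
    isMinusType_formShift_hyperbolicForm (Classical.arbitrary l) hb⟩

omit [Finite F] [CharP F 2] in
theorem HasWittIndex.formComp {Q : QuadraticForm F (l ⊕ l → F)} {k : ℕ} (h : HasWittIndex Q k)
    (A : symplecticGroup l F) : HasWittIndex (formComp Q A) k := by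
  refine ⟨exists_singular_formComp h.1 A, fun d hd => h.2 ?_⟩
  have := exists_singular_formComp hd A⁻¹
  rwa [← formComp_mul, mul_inv_cancel, formComp_one] at this

/-- The forms of minus type are those without a Lagrangian. -/
theorem isMinusType_iff_not_hasLagrangian [Nonempty l] {Q : QuadraticForm F (l ⊕ l → F)}
    (hQ : PolarizesToSymplectic Q) : IsMinusType Q ↔ ¬ HasLagrangian Q := by
  refine ⟨IsMinusType.not_hasLagrangian, fun h => ?_⟩
  obtain ⟨Q', hQ', h'⟩ := exists_isMinusType (l := l) F
  obtain ⟨S, rfl⟩ := exists_formComp_eq_of_not_hasLagrangian hQ' hQ h'.not_hasLagrangian h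
  obtain ⟨k, hk, h'⟩ := h'
  exact ⟨k, hk, h'.formComp S⟩

end Types

/-! ### The group `Ω(Q)` -/

section Omega

variable {l F : Type*} [DecidableEq l] [Fintype l] [Field F] [CharP F 2]

theorem sq_mem_omegaGroup {Q : QuadraticForm F (l ⊕ l → F)} (hQ : PolarizesToSymplectic Q)
    {g : symplecticGroup l F} (hg : g ∈ generalOrthogonal Q) : g ^ 2 ∈ omegaGroup Q hQ := by
  refine ⟨pow_mem hg 2, ?_⟩
  have h := even_rank_mul_sub_one_of_mem hQ hg hg
  rw [sq]
  rw [Nat.even_iff] at *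
  omega

theorem mem_omegaGroup_of_odd_orderOf {Q : QuadraticForm F (l ⊕ l → F)}
    (hQ : PolarizesToSymplectic Q) {g : symplecticGroup l F} (hg : g ∈ generalOrthogonal Q)
    (ho : Odd (orderOf g)) : g ∈ omegaGroup Q hQ := by
  obtain ⟨k, hk⟩ := ho
  have h : g = (g ^ 2) ^ (k + 1) := by
    rw [← pow_mul, show 2 * (k + 1) = orderOf g + 1 by omega, pow_add, pow_orderOf_eq_one, one_mul,
      pow_one]
  rw [h]
  exact pow_mem (sq_mem_omegaGroup hQ hg) _

theorem conj_mem_omegaGroup {Q : QuadraticForm F (l ⊕ l → F)} (hQ : PolarizesToSymplectic Q)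
    (S : symplecticGroup l F) {g : symplecticGroup l F}
    (hg : g ∈ omegaGroup (formComp Q S) (hQ.formComp S)) : S * g * S⁻¹ ∈ omegaGroup Q hQ := by
  refine ⟨fun v => ?_, ?_⟩
  · have := hg.1 ((S⁻¹).1 *ᵥ v)
    rw [formComp_apply, formComp_apply, mulVec_inv_mulVec] at this
    rw [Submonoid.coe_mul, Submonoid.coe_mul, ← Matrix.mulVec_mulVec, ← Matrix.mulVec_mulVec]
    exact this
  · have h1 : ((S * g * S⁻¹ : symplecticGroup l F) : Matrix (l ⊕ l) (l ⊕ l) F) - 1 =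
        S.1 * (g.1 - 1) * (S⁻¹).1 := by
      have h2 : S.1 * (S⁻¹).1 = 1 := by
        rw [← Submonoid.coe_mul, mul_inv_cancel, Submonoid.coe_one]
      rw [mul_sub, sub_mul, mul_one, h2]
      rfl
    rw [h1, Matrix.rank_mul_eq_left_of_isUnit_det _ _ (SymplecticGroup.symplectic_det (S⁻¹).2),
      Matrix.rank_mul_eq_right_of_isUnit_det _ _ (SymplecticGroup.symplectic_det S.2)]
    exact hg.2

/-- Equivalent forms have conjugate groups `Ω`, so an element may be sought in `Ω(Q')` for whichever
minus form `Q'` is convenient. -/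
theorem orderOf_dvd_exponent_omegaGroup [Finite F] {Q Q' : QuadraticForm F (l ⊕ l → F)}
    (hQ : PolarizesToSymplectic Q) (hQ' : PolarizesToSymplectic Q') (h : IsMinusType Q)
    (h' : IsMinusType Q') {g : symplecticGroup l F} (hg : g ∈ omegaGroup Q' hQ') :
    orderOf g ∣ Monoid.exponent (omegaGroup Q hQ) := by
  obtain ⟨S, rfl⟩ := exists_formComp_eq_of_not_hasLagrangian hQ hQ' h.not_hasLagrangian
    h'.not_hasLagrangian
  have h1 := Monoid.order_dvd_exponent (⟨S * g * S⁻¹, conj_mem_omegaGroup hQ S hg⟩ :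
    omegaGroup Q hQ)
  rw [← Subgroup.orderOf_coe] at h1
  have h2 : orderOf (MulAut.conj S g) = orderOf g := MulEquiv.orderOf_eq _ _
  rw [← h2]
  exact h1

/-- The transvection along a singular vector `u` adds `B(·, u)²` to `Q`, so it is symplectic but not
an isometry. -/
theorem omegaGroup_ne_top {Q : QuadraticForm F (l ⊕ l → F)} (hQ : PolarizesToSymplectic Q)
    {u : l ⊕ l → F} (hu : u ≠ 0) (hQu : Q u = 0) : omegaGroup Q hQ ≠ ⊤ := by
  intro h
  have h1 : symplecticTransvection 1 u ∈ omegaGroup Q hQ := h ▸ Subgroup.mem_top _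
  apply hu
  apply eq_zero_of_symplecticForm
  intro v
  have h2 := h1.1 v
  rw [← formComp_apply, formComp_symplecticTransvection_apply hQ, hQu] at h2
  simpa using h2

omit [DecidableEq l] [CharP F 2] in
theorem IsMinusType.exists_singular {Q : QuadraticForm F (l ⊕ l → F)} (h : IsMinusType Q)
    (hl : 2 ≤ Fintype.card l) : ∃ u, u ≠ 0 ∧ Q u = 0 := by
  obtain ⟨k, hk, ⟨W, hd, hW⟩, -⟩ := h
  have : W ≠ ⊥ := by
    rintro rfl
    rw [finrank_bot] at hd
    omega
  obtain ⟨u, hu, hu0⟩ := W.exists_mem_ne_zero_of_ne_bot this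
  exact ⟨u, hu0, hW u hu⟩

theorem mk'_center_symplecticGroup_bijective :
    Function.Bijective (QuotientGroup.mk' (Subgroup.center (symplecticGroup l F))) := by
  refine ⟨?_, QuotientGroup.mk'_surjective _⟩
  rw [← MonoidHom.ker_eq_bot_iff, QuotientGroup.ker_mk', center_symplecticGroup_eq_bot]

end Omega

/-- If every `p`-power element order of `G` divides `n`, so does the exponent. -/
theorem exponent_dvd_of_prime_pow {G : Type*} [Group G] [Finite G] {n : ℕ}
    (h : ∀ (p k : ℕ) (g : G), p.Prime → orderOf g = p ^ k → p ^ k ∣ n) : Monoid.exponent G ∣ n := by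
  rw [Monoid.exponent_dvd]
  intro g
  rw [Nat.dvd_iff_prime_pow_dvd_dvd]
  intro p k hp hk
  obtain ⟨d, hd⟩ := hk
  have h0 := orderOf_pos g
  have hd0 : d ≠ 0 := by
    rintro rfl
    omega
  refine h p k (g ^ d) hp ?_
  rw [orderOf_pow_of_dvd hd0 ⟨p ^ k, by rw [hd, mul_comm]⟩, hd]
  exact Nat.mul_div_cancel _ (Nat.pos_of_ne_zero hd0)

/-! ### Orders of semisimple symplectic matrices -/

section SemisimpleOrder

open Polynomial

/-- The minimal polynomial of a matrix of prime power order, prime to the characteristic, has a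
root of that order. -/
theorem exists_root_minpoly_orderOf_eq {n F : Type*} [DecidableEq n] [Fintype n] [Field F]
    (A : Matrix n n F) {p k : ℕ} [Fact p.Prime] (hpF : (p : F) ≠ 0)
    (hA : A ^ p ^ (k + 1) = 1) (hA' : A ^ p ^ k ≠ 1) :
    ∃ α : AlgebraicClosure F, aeval α (minpoly F A) = 0 ∧ orderOf α = p ^ (k + 1) := by
  have hdvd : minpoly F A ∣ X ^ p ^ (k + 1) - 1 := minpoly.dvd F A (by simp [hA])
  have hsep : (X ^ p ^ (k + 1) - 1 : F[X]).Separable := by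
    refine Polynomial.X_pow_sub_one_separable_iff.2 ?_
    push_cast
    exact pow_ne_zero _ hpF
  have h1 : ∀ α : AlgebraicClosure F, aeval α (minpoly F A) = 0 → α ^ p ^ (k + 1) = 1 := by
    intro α hα
    obtain ⟨c, hc⟩ := hdvd
    have := congrArg (aeval α) hc
    rw [map_mul, hα, zero_mul] at this
    simpa [sub_eq_zero] using this
  by_contra! hcon
  have h2 : ∀ α : AlgebraicClosure F, aeval α (minpoly F A) = 0 → α ^ p ^ k = 1 := by
    intro α hα
    by_contra h
    exact hcon α hα (orderOf_eq_prime_pow h (h1 α hα))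
  apply hA'
  -- The minimal polynomial is separable, so divisibility only has to be checked on its roots in the
  -- algebraic closure.
  have h3 : minpoly F A ∣ X ^ p ^ k - 1 := by
    rw [← Polynomial.map_dvd_map' (algebraMap F (AlgebraicClosure F))]
    have hne : (minpoly F A).map (algebraMap F (AlgebraicClosure F)) ≠ 0 :=
      Polynomial.map_ne_zero (minpoly.ne_zero (Matrix.isIntegral A))
    refine Polynomial.Splits.dvd_of_roots_le_roots (IsAlgClosed.splits _) hne ?_
    have hnd : ((minpoly F A).map (algebraMap F (AlgebraicClosure F))).roots.Nodup :=
      Polynomial.nodup_roots ((hsep.of_dvd hdvd).map)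
    rw [Multiset.le_iff_subset hnd]
    intro α hα
    have hα' := h2 α (by
      rw [Polynomial.mem_roots hne] at hα
      simpa [Polynomial.IsRoot, Polynomial.eval_map_algebraMap] using hα)
    rw [Polynomial.mem_roots']
    refine ⟨?_, by simp [hα']⟩
    rw [Polynomial.map_sub, Polynomial.map_pow, Polynomial.map_X, Polynomial.map_one]
    exact Polynomial.X_pow_sub_C_ne_zero (pow_pos (Fact.out : p.Prime).pos _) 1
  obtain ⟨c, hc⟩ := h3
  have := congrArg (aeval A) hc
  rw [map_mul, minpoly.aeval, zero_mul] at this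
  simpa [sub_eq_zero] using this

/-- If `α` and `α⁻¹` have the same minimal polynomial of odd degree over a finite field, then
`α ^ 2 = 1`. -/
theorem sq_eq_one_of_minpoly_inv_eq {F K : Type*} [Field F] [Finite F] [Field K] [Algebra F K]
    {α : K} (hα : IsIntegral F α) (h0 : α ≠ 0) (hodd : Odd (minpoly F α).natDegree)
    (h : minpoly F α = minpoly F α⁻¹) : α ^ 2 = 1 := by
  have : FiniteDimensional F (IntermediateField.adjoin F {α}) :=
    IntermediateField.adjoin.finiteDimensional hα
  have : Finite (IntermediateField.adjoin F {α}) := Module.finite_of_finite F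
  set a := IntermediateField.AdjoinSimple.gen F α with ha
  have haα : algebraMap (IntermediateField.adjoin F {α}) K a = α :=
    IntermediateField.AdjoinSimple.algebraMap_gen F α
  have hmin : minpoly F a = minpoly F α := IntermediateField.minpoly_gen F α
  have hmin' : minpoly F a⁻¹ = minpoly F α⁻¹ := by
    rw [← minpoly.algebraMap_eq (algebraMap (IntermediateField.adjoin F {α}) K).injective, map_inv₀,
      haα]
  -- Inversion of `α` is induced by an automorphism `σ` of `F(α)` with `σ²` fixing `α`. The Galois
  -- group has odd order, so `σ` itself fixes `α`.
  obtain ⟨σ, hσ⟩ := minpoly.exists_algEquiv_of_root' (K := F) (x := a⁻¹) (y := a)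
    (Algebra.IsAlgebraic.isAlgebraic a) (by rw [hmin, h, ← hmin']; exact minpoly.aeval _ _)
  have hcard : Nat.card Gal(IntermediateField.adjoin F {α}/F) = (minpoly F α).natDegree := by
    rw [IsGalois.card_aut_eq_finrank, IntermediateField.adjoin.finrank hα]
  have hσ2 : (σ ^ 2) a = a := by
    rw [sq, AlgEquiv.mul_apply, hσ, map_inv₀, hσ, inv_inv]
  obtain ⟨k, hk⟩ := hodd
  have hσ1 : σ a = a := by
    have h1 : σ ^ (2 * k + 1) = 1 := by rw [← hk, ← hcard, pow_card_eq_one']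
    have h2 : ∀ j : ℕ, ((σ ^ 2) ^ j) a = a := by
      intro j
      induction j with
      | zero => rfl
      | succ j ih => rw [pow_succ, AlgEquiv.mul_apply, hσ2, ih]
    have h3 := congrArg (fun τ => τ a) h1
    rw [pow_succ', pow_mul] at h3
    simpa [AlgEquiv.mul_apply, h2] using h3
  have h4 := congrArg (algebraMap (IntermediateField.adjoin F {α}) K) (hσ.symm.trans hσ1)
  rw [map_inv₀, haα] at h4
  rw [sq]
  nth_rewrite 1 [← h4]
  exact inv_mul_cancel₀ h0

theorem aeval_charpoly_eq_det {n F K : Type*} [DecidableEq n] [Fintype n] [Field F] [Field K]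
    [Algebra F K] (A : Matrix n n F) (α : K) :
    aeval α A.charpoly = (Matrix.scalar n α - A.map (algebraMap F K)).det := by
  rw [← Matrix.eval_charpoly, Matrix.charpoly_map, Polynomial.eval_map_algebraMap]

/-- From `Mᵀ J M = J` one gets `Mᵀ J (α⁻¹ - M) = -α⁻¹ (α - M)ᵀ J`; taking determinants shows that
eigenvalues come in inverse pairs. -/
theorem aeval_charpoly_inv_eq_zero {l F K : Type*} [DecidableEq l] [Fintype l] [Field F] [Field K]
    [Algebra F K] {A : Matrix (l ⊕ l) (l ⊕ l) F} (hA : A ∈ symplecticGroup l F) {α : K}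
    (h0 : α ≠ 0) (hα : aeval α A.charpoly = 0) : aeval α⁻¹ A.charpoly = 0 := by
  rw [aeval_charpoly_eq_det] at hα ⊢
  have hM := SymplecticGroup.map_mem hA (algebraMap F K)
  set M := A.map (algebraMap F K)
  have h1 : Mᵀ * J l K * (Matrix.scalar (l ⊕ l) α⁻¹ - M) =
      (-α⁻¹) • ((Matrix.scalar (l ⊕ l) α - M)ᵀ * J l K) := by
    rw [mul_sub, SymplecticGroup.mem_iff'.1 hM, Matrix.transpose_sub, sub_mul, smul_sub]
    simp only [Matrix.scalar_apply, ← Matrix.smul_one_eq_diagonal, Matrix.transpose_smul,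
      Matrix.transpose_one, Matrix.smul_mul, Matrix.mul_smul, one_mul, mul_one, smul_smul, neg_mul,
      inv_mul_cancel₀ h0, neg_smul, one_smul]
    abel
  have h2 := congrArg Matrix.det h1
  rw [Matrix.det_mul, Matrix.det_mul, Matrix.det_smul, Matrix.det_mul, Matrix.det_transpose (_ - M),
    hα, zero_mul, mul_zero] at h2
  refine (mul_eq_zero.1 h2).resolve_left (mul_ne_zero ?_ (Matrix.isUnit_det_J l K).ne_zero)
  rw [Matrix.det_transpose]
  exact (SymplecticGroup.symplectic_det hM).ne_zero

theorem orderOf_dvd_card_pow_sub_one {F K : Type*} [Field F] [Finite F] [Field K] [Algebra F K]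
    {α : K} (hα : IsIntegral F α) (h0 : α ≠ 0) :
    orderOf α ∣ Nat.card F ^ (minpoly F α).natDegree - 1 := by
  have : FiniteDimensional F (IntermediateField.adjoin F {α}) :=
    IntermediateField.adjoin.finiteDimensional hα
  have : Finite (IntermediateField.adjoin F {α}) := Module.finite_of_finite F
  have := Fintype.ofFinite (IntermediateField.adjoin F {α})
  apply orderOf_dvd_of_pow_eq_one
  have h := FiniteField.pow_card_sub_one_eq_one (IntermediateField.AdjoinSimple.gen F α) (by
    intro h
    apply h0
    rw [← IntermediateField.AdjoinSimple.algebraMap_gen F α, h, map_zero])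
  rw [← Nat.card_eq_fintype_card, Module.natCard_eq_pow_finrank (K := F),
    IntermediateField.adjoin.finrank hα] at h
  have := congrArg (algebraMap _ K) h
  rwa [map_pow, map_one, IntermediateField.AdjoinSimple.algebraMap_gen] at this

/-- Let `α` be an eigenvalue of the full order and `d` its degree over `F`, so the order divides
`q^d - 1`. If `d` is even, `i = d / 2` works. If `d` is odd, `α` and `α⁻¹` are not conjugate, since
otherwise `α² = 1`; their distinct minimal polynomials both divide the characteristic polynomial, so
`2d ≤ 2m` and `i = d` works. -/
theorem dvd_card_pow_sub_one_of_symplectic {l F : Type*} [DecidableEq l] [Fintype l] [Field F]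
    [Finite F] (A : symplecticGroup l F) {p k : ℕ} [Fact p.Prime] (hp2 : p ≠ 2)
    (hpF : (p : F) ≠ 0) (hA : orderOf A = p ^ (k + 1)) :
    ∃ i, 0 < i ∧ i ≤ Fintype.card l ∧ p ^ (k + 1) ∣ Nat.card F ^ (2 * i) - 1 := by
  have hp : p.Prime := Fact.out
  have hA1 : A.1 ^ p ^ (k + 1) = 1 := by
    rw [← SubmonoidClass.coe_pow, ← hA, pow_orderOf_eq_one, Submonoid.coe_one]
  have hA2 : A.1 ^ p ^ k ≠ 1 := by
    rw [← SubmonoidClass.coe_pow, ← Submonoid.coe_one, Ne, Subtype.val_inj,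
      ← orderOf_dvd_iff_pow_eq_one, hA, Nat.pow_dvd_pow_iff_le_right hp.one_lt]
    omega
  obtain ⟨α, hα, ho⟩ := exists_root_minpoly_orderOf_eq A.1 hpF hA1 hA2
  have hint : IsIntegral F α := Algebra.IsIntegral.isIntegral α
  have h0 : α ≠ 0 := by
    rintro rfl
    rw [orderOf_zero] at ho
    exact pow_ne_zero _ hp.ne_zero ho.symm
  have hchar : aeval α A.1.charpoly = 0 := by
    obtain ⟨c, hc⟩ := Matrix.minpoly_dvd_charpoly A.1
    rw [hc, map_mul, hα, zero_mul]
  have hchar' : aeval α⁻¹ A.1.charpoly = 0 := aeval_charpoly_inv_eq_zero A.2 h0 hchar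
  have hd1 := minpoly.dvd F α hchar
  have hd2 := minpoly.dvd F α⁻¹ hchar'
  have hdeg : A.1.charpoly.natDegree = 2 * Fintype.card l := by
    rw [Matrix.charpoly_natDegree_eq_dim, Fintype.card_sum, two_mul]
  have hcne : A.1.charpoly ≠ 0 := (Matrix.charpoly_monic _).ne_zero
  have hpos := minpoly.natDegree_pos hint
  have hdvd := orderOf_dvd_card_pow_sub_one hint h0
  rw [ho] at hdvd
  have hle := Polynomial.natDegree_le_of_dvd hd1 hcne
  rcases Nat.even_or_odd (minpoly F α).natDegree with he | he
  · obtain ⟨i, hi⟩ := he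
    refine ⟨i, by omega, by omega, ?_⟩
    rwa [hi, ← two_mul] at hdvd
  · refine ⟨(minpoly F α).natDegree, hpos, ?_, ?_⟩
    · have hne : minpoly F α ≠ minpoly F α⁻¹ := by
        intro h
        have h1 := orderOf_dvd_of_pow_eq_one (sq_eq_one_of_minpoly_inv_eq hint h0 he h)
        rw [ho, pow_succ'] at h1
        exact hp2 ((Nat.prime_dvd_prime_iff_eq hp Nat.prime_two).1 (dvd_of_mul_right_dvd h1))
      have hint' : IsIntegral F α⁻¹ := Algebra.IsIntegral.isIntegral _
      have hirr := minpoly.irreducible hint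
      have hirr' := minpoly.irreducible hint'
      have hcop : IsCoprime (minpoly F α) (minpoly F α⁻¹) := by
        rw [hirr.coprime_iff_not_dvd]
        intro hd
        exact hne (Polynomial.eq_of_monic_of_associated (minpoly.monic hint) (minpoly.monic hint')
          (hirr.associated_of_dvd hirr' hd))
      have h2 := Polynomial.natDegree_le_of_dvd (hcop.mul_dvd hd1 hd2) hcne
      rw [Polynomial.natDegree_mul hirr.ne_zero hirr'.ne_zero] at h2
      have h3 : (minpoly F α).natDegree = (minpoly F α⁻¹).natDegree := by
        have h4 : IntermediateField.adjoin F {α} = IntermediateField.adjoin F {α⁻¹} := by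
          refine le_antisymm ?_ ?_ <;> rw [IntermediateField.adjoin_simple_le_iff]
          · simpa using inv_mem (IntermediateField.mem_adjoin_simple_self F α⁻¹)
          · exact inv_mem (IntermediateField.mem_adjoin_simple_self F α)
        rw [← IntermediateField.adjoin.finrank hint, ← IntermediateField.adjoin.finrank hint', h4]
      omega
    · refine hdvd.trans ?_
      rw [mul_comm, pow_mul]
      simpa using Nat.sub_dvd_pow_sub_pow (Nat.card F ^ (minpoly F α).natDegree) 1 2

end SemisimpleOrder

/-! ### Embedding `SL₂` over a commutative algebra into the symplectic group -/

section Embedding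

variable {l F R : Type*} [DecidableEq l] [Fintype l] [Field F] [CommRing R]

/-- The block matrix attached to a `2 × 2` matrix over `R` and a representation `θ` of `R`; the
second half of the coordinates is twisted by `P`. -/
noncomputable def twistedBlocks (θ : R →+* Matrix l l F) (P : Matrix l l F) (M : Matrix (Fin 2) (Fin 2) R) :
    Matrix (l ⊕ l) (l ⊕ l) F :=
  fromBlocks (θ (M 0 0)) (θ (M 0 1) * P⁻¹) (P * θ (M 1 0)) (P * θ (M 1 1) * P⁻¹)

variable {θ : R →+* Matrix l l F} {P : Matrix l l F}

theorem twistedBlocks_one (hP : IsUnit P.det) : twistedBlocks θ P 1 = 1 := by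
  simp [twistedBlocks, Matrix.mul_nonsing_inv P hP]

theorem twistedBlocks_mul (hP : IsUnit P.det) (M N : Matrix (Fin 2) (Fin 2) R) :
    twistedBlocks θ P (M * N) = twistedBlocks θ P M * twistedBlocks θ P N := by
  simp only [twistedBlocks, fromBlocks_multiply, Matrix.mul_apply, Fin.sum_univ_two, map_add,
    map_mul, Matrix.mul_add, Matrix.add_mul, Matrix.mul_assoc,
    Matrix.nonsing_inv_mul_cancel_left P _ hP]

/-- Self-adjointness says `(θ r)ᵀ = P (θ r) P⁻¹`, which turns the identity `Mᵀ J M = det M • J` for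
`2 × 2` matrices over `R` into one over `F`. The case of determinant other than `1` is needed for
the idempotent scalar matrix in `exists_fixed_pair_specialLinearToSymplectic`. -/
theorem twistedBlocks_transpose_mul_J_mul (hP : IsUnit P.det) (hPt : Pᵀ = P)
    (hθ : ∀ r, (P * θ r)ᵀ = P * θ r) (M : Matrix (Fin 2) (Fin 2) R) :
    (twistedBlocks θ P M)ᵀ * J l F * twistedBlocks θ P M =
      fromBlocks 0 (-(P * θ M.det * P⁻¹)) (θ M.det) 0 := by
  have h1 : ∀ r, (θ r)ᵀ = P * θ r * P⁻¹ := by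
    intro r
    rw [← hθ r, Matrix.transpose_mul, hPt, Matrix.mul_nonsing_inv_cancel_right P _ hP]
  have hPi : (P⁻¹)ᵀ = P⁻¹ := by rw [Matrix.transpose_nonsing_inv, hPt]
  have hc : ∀ r s, θ r * θ s = θ s * θ r := fun r s => by rw [← map_mul, mul_comm, map_mul]
  rw [twistedBlocks, fromBlocks_transpose, J, fromBlocks_multiply, fromBlocks_multiply,
    Matrix.det_fin_two]
  congr 1
  · rw [hθ, h1]
    simp [Matrix.mul_assoc, Matrix.nonsing_inv_mul_cancel_left P _ hP, hc (M 0 0)]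
  · rw [hθ, h1]
    simp [Matrix.mul_assoc, Matrix.nonsing_inv_mul_cancel_left P _ hP, mul_sub, sub_mul]
    rw [← Matrix.mul_assoc (θ (M 1 0)), hc (M 1 0), Matrix.mul_assoc]
    abel
  · simp only [Matrix.transpose_mul, hPi, h1, hPt]
    simp [Matrix.mul_assoc, Matrix.nonsing_inv_mul_cancel_left P _ hP,
      Matrix.nonsing_inv_mul P hP, hc (M 1 1)]
    abel
  · simp only [Matrix.transpose_mul, hPi, h1, hPt]
    simp [Matrix.mul_assoc, Matrix.nonsing_inv_mul_cancel_left P _ hP,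
      Matrix.nonsing_inv_mul P hP]
    rw [← Matrix.mul_assoc (θ (M 1 1)), hc (M 1 1), Matrix.mul_assoc]
    abel

/-- The homomorphism `SL₂(R) → Sp` attached to a representation `θ` of `R` that is self-adjoint
with respect to a nondegenerate symmetric bilinear form with Gram matrix `P`. -/
noncomputable def specialLinearToSymplectic (θ : R →+* Matrix l l F) (P : Matrix l l F) (hP : IsUnit P.det)
    (hPt : Pᵀ = P) (hθ : ∀ r, (P * θ r)ᵀ = P * θ r) :
    SpecialLinearGroup (Fin 2) R →* symplecticGroup l F where
  toFun M := ⟨twistedBlocks θ P M.1, by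
    rw [SymplecticGroup.mem_iff', twistedBlocks_transpose_mul_J_mul hP hPt hθ, M.2, map_one,
      Matrix.mul_one, Matrix.mul_nonsing_inv P hP, J]⟩
  map_one' := Subtype.ext (twistedBlocks_one hP)
  map_mul' M N := Subtype.ext (twistedBlocks_mul hP M.1 N.1)

theorem specialLinearToSymplectic_injective (hP : IsUnit P.det) (hPt : Pᵀ = P)
    (hθ : ∀ r, (P * θ r)ᵀ = P * θ r) (hinj : Function.Injective θ) :
    Function.Injective (specialLinearToSymplectic θ P hP hPt hθ) := by
  rw [injective_iff_map_eq_one]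
  intro M hM
  have h1 : twistedBlocks θ P M.1 = 1 := congrArg Subtype.val hM
  rw [twistedBlocks, ← fromBlocks_one, fromBlocks_inj] at h1
  obtain ⟨h00, h01, h10, h11⟩ := h1
  have e00 : M.1 0 0 = 1 := hinj (by rw [h00, map_one])
  have e01 : M.1 0 1 = 0 := hinj (by
    rw [map_zero, ← Matrix.nonsing_inv_mul_cancel_right P (θ (M.1 0 1)) hP, h01, Matrix.zero_mul])
  have e10 : M.1 1 0 = 0 := hinj (by
    rw [map_zero, ← Matrix.nonsing_inv_mul_cancel_left P (θ (M.1 1 0)) hP, h10, Matrix.mul_zero])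
  have e11 : M.1 1 1 = 1 := hinj (by
    rw [map_one, ← Matrix.nonsing_inv_mul_cancel_left P (θ (M.1 1 1)) hP,
      ← Matrix.nonsing_inv_mul_cancel_right P (P * θ (M.1 1 1)) hP, h11, Matrix.one_mul,
      Matrix.nonsing_inv_mul P hP])
  refine Subtype.ext ?_
  ext i j
  fin_cases i <;> fin_cases j <;> simp [e00, e01, e10, e11]

/-- If `M` fixes the idempotent `ε`, then its image fixes a pair of nonorthogonal vectors. -/
theorem exists_fixed_pair_specialLinearToSymplectic (hP : IsUnit P.det) (hPt : Pᵀ = P)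
    (hθ : ∀ r, (P * θ r)ᵀ = P * θ r) {ε : R} (hε : ε * ε = ε) (hε0 : θ ε ≠ 0)
    (M : SpecialLinearGroup (Fin 2) R) (hM : M.1 * Matrix.scalar (Fin 2) ε = Matrix.scalar _ ε) :
    ∃ u u', (specialLinearToSymplectic θ P hP hPt hθ M).1 *ᵥ u = u ∧
      (specialLinearToSymplectic θ P hP hPt hθ M).1 *ᵥ u' = u' ∧ symplecticForm l F u u' ≠ 0 := by
  obtain ⟨i, j, hij⟩ : ∃ i j, (θ ε)ᵀ i j ≠ 0 := by
    by_contra! h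
    exact hε0 (Matrix.ext fun i j => h j i)
  -- Since `M ε = ε`, the range of `E` is fixed pointwise. On this range the form is governed by `θ
  -- (ε²) = θ ε`, so a nonzero entry of `(θ ε)ᵀ` selects the two basis vectors.
  set E := twistedBlocks θ P (Matrix.scalar (Fin 2) ε) with hE
  have hfix : ∀ v, (specialLinearToSymplectic θ P hP hPt hθ M).1 *ᵥ (E *ᵥ v) = E *ᵥ v := by
    intro v
    rw [Matrix.mulVec_mulVec]
    change (twistedBlocks θ P M.1 * E) *ᵥ v = _
    rw [hE, ← twistedBlocks_mul hP, hM]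
  refine ⟨E *ᵥ Pi.single (.inl i) 1, E *ᵥ Pi.single (.inr j) 1, hfix _, hfix _, ?_⟩
  have h1 := Matrix.toBilin'_comp (J l F) E E
  rw [hE, twistedBlocks_transpose_mul_J_mul hP hPt hθ, ← hE] at h1
  have h2 := LinearMap.congr_fun₂ h1 (Pi.single (.inl i) 1) (Pi.single (.inr j) 1)
  change symplecticForm l F (E *ᵥ _) (E *ᵥ _) = _ at h2
  rw [h2, Matrix.toBilin'_single, fromBlocks_apply₁₂, Matrix.neg_apply, neg_ne_zero]
  have h3 : P * θ ε * P⁻¹ = (θ ε)ᵀ := by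
    rw [← hθ ε, Matrix.transpose_mul, hPt, Matrix.mul_nonsing_inv_cancel_right P _ hP]
  rw [Matrix.det_fin_two]
  simpa [hε, h3] using hij

end Embedding

/-! ### Elements of `SL₂` over a finite field, and their images in the symplectic group. -/

section Torus

theorem exists_orderOf_units_eq {K : Type*} [Field K] [Finite K] {n : ℕ}
    (hn : n ∣ Nat.card K - 1) : ∃ ζ : Kˣ, orderOf ζ = n := by
  obtain ⟨g, hg⟩ := IsCyclic.exists_ofOrder_eq_natCard (α := Kˣ)
  rw [Nat.card_units] at hg
  obtain ⟨d, hd⟩ := hn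
  have hpos : 0 < Nat.card K - 1 := by
    have := Finite.one_lt_card (α := K)
    omega
  have hd0 : d ≠ 0 := by
    rintro rfl
    omega
  refine ⟨g ^ d, ?_⟩
  rw [orderOf_pow_of_dvd hd0 ⟨n, by rw [hg, hd, mul_comm]⟩, hg, hd]
  exact Nat.mul_div_cancel _ (Nat.pos_of_ne_zero hd0)

/-- The diagonal torus of `SL₂`. -/
def diagonalTorus (L : Type*) [Field L] : Lˣ →* SpecialLinearGroup (Fin 2) L where
  toFun ζ := ⟨Matrix.diagonal ![(ζ : L), (ζ⁻¹ : Lˣ)], by simp⟩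
  map_one' := by
    ext i j
    fin_cases i <;> fin_cases j <;> simp
  map_mul' a b := by
    refine Subtype.ext ?_
    change Matrix.diagonal _ = Matrix.diagonal _ * Matrix.diagonal _
    rw [Matrix.diagonal_mul_diagonal]
    congr 1
    ext i
    fin_cases i <;> simp [mul_comm]

theorem diagonalTorus_injective (L : Type*) [Field L] :
    Function.Injective (diagonalTorus L) := by
  intro a b h
  have := congrArg (fun M : SpecialLinearGroup (Fin 2) L => M.1 0 0) h
  exact Units.ext this

/-- The nonsplit torus: elements of norm one in the quadratic extension act on it by multiplication
with determinant one. The norm is the power map with exponent `|L| + 1`, so it kills elements whose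
order divides `|L| + 1`. -/
theorem exists_orderOf_specialLinear_of_dvd_add_one (L : Type*) [Field L] [Finite L] (p : ℕ)
    [Fact p.Prime] [CharP L p] {n : ℕ} (hn : n ∣ Nat.card L + 1) :
    ∃ M : SpecialLinearGroup (Fin 2) L, orderOf M = n := by
  let K := FiniteField.Extension L p 2
  have hK : Nat.card K = Nat.card L ^ 2 := FiniteField.natCard_extension L p 2
  have hq : Nat.card K - 1 = (Nat.card L - 1) * (Nat.card L + 1) := by
    rw [hK, mul_comm, ← Nat.sq_sub_sq, one_pow]
  obtain ⟨ζ, hζ⟩ := exists_orderOf_units_eq (K := K) (hq ▸ hn.mul_left _)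
  have hnorm : Algebra.norm L (ζ : K) = 1 := by
    apply (algebraMap L K).injective
    have hL : 0 < Nat.card L - 1 := by
      have := Finite.one_lt_card (α := L)
      omega
    rw [FiniteField.algebraMap_norm_eq_pow, hq, Nat.mul_div_cancel_left _ hL, map_one,
      ← Units.val_pow_eq_pow_val, orderOf_dvd_iff_pow_eq_one.1 (hζ ▸ hn), Units.val_one]
  let b : Basis (Fin 2) L K := Module.finBasisOfFinrankEq L K (FiniteField.finrank_extension L p 2)
  refine ⟨⟨Algebra.leftMulMatrix b ζ, by rw [← Algebra.norm_eq_matrix_det, hnorm]⟩, ?_⟩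
  have h1 : orderOf (Algebra.leftMulMatrix b (ζ : K)) = orderOf (ζ : K) :=
    orderOf_injective (Algebra.leftMulMatrix b).toMonoidHom (Algebra.leftMulMatrix_injective b) _
  rw [← hζ, ← orderOf_units, ← h1]
  exact (orderOf_injective (SpecialLinearGroup.coeMonoidHom (ι := Fin 2) (R := L))
    SpecialLinearGroup.coeMonoidHom_injective _).symm

/-- An odd prime power dividing `(a - 1) (a + 1)` divides one of the factors. -/
theorem prime_pow_dvd_sub_one_or_add_one {p k a : ℕ} (hp : p.Prime) (hp2 : p ≠ 2)
    (h : p ^ k ∣ (a - 1) * (a + 1)) (ha : 0 < a) : p ^ k ∣ a - 1 ∨ p ^ k ∣ a + 1 := by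
  by_cases h1 : p ∣ a - 1
  · left
    have h2 : ¬ p ∣ a + 1 := by
      intro h2
      have h3 := (Nat.dvd_add_iff_right h1 (n := 2)).2 (by rwa [show a - 1 + 2 = a + 1 by omega])
      exact hp2 ((Nat.prime_dvd_prime_iff_eq hp Nat.prime_two).1 h3)
    exact (Nat.Coprime.pow_left k ((Nat.Prime.coprime_iff_not_dvd hp).2 h2)).dvd_of_dvd_mul_right h
  · right
    exact (Nat.Coprime.pow_left k ((Nat.Prime.coprime_iff_not_dvd hp).2 h1)).dvd_of_dvd_mul_left h

theorem exists_orderOf_specialLinear (L : Type*) [Field L] [Finite L] (r : ℕ)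
    [Fact r.Prime] [CharP L r] {p k : ℕ} (hp : p.Prime) (hp2 : p ≠ 2)
    (h : p ^ k ∣ Nat.card L ^ 2 - 1) : ∃ M : SpecialLinearGroup (Fin 2) L, orderOf M = p ^ k := by
  have hq : Nat.card L ^ 2 - 1 = (Nat.card L - 1) * (Nat.card L + 1) := by
    rw [mul_comm, ← Nat.sq_sub_sq, one_pow]
  rw [hq] at h
  rcases prime_pow_dvd_sub_one_or_add_one hp hp2 h Nat.card_pos with h | h
  · obtain ⟨ζ, hζ⟩ := exists_orderOf_units_eq h
    exact ⟨diagonalTorus L ζ, by rw [orderOf_injective _ (diagonalTorus_injective L), hζ]⟩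
  · exact exists_orderOf_specialLinear_of_dvd_add_one L r h

/-- The matrix `(M, 1)` over `L × F`. -/
def matrixInl {L : Type*} (F : Type*) [CommRing L] [CommRing F] (M : Matrix (Fin 2) (Fin 2) L) :
    Matrix (Fin 2) (Fin 2) (L × F) :=
  Matrix.of fun i j => (M i j, (1 : Matrix (Fin 2) (Fin 2) F) i j)

theorem matrixInl_mul {L F : Type*} [CommRing L] [CommRing F] (M N : Matrix (Fin 2) (Fin 2) L) :
    matrixInl F (M * N) = matrixInl F M * matrixInl F N := by
  refine Matrix.ext fun i j => ?_
  fin_cases i <;> fin_cases j <;> simp [matrixInl, Matrix.mul_apply, Fin.sum_univ_two]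

/-- The embedding `M ↦ (M, 1)` of `SL₂(L)` into `SL₂(L × F)`. -/
def specialLinearInl (L F : Type*) [CommRing L] [CommRing F] :
    SpecialLinearGroup (Fin 2) L →* SpecialLinearGroup (Fin 2) (L × F) where
  toFun M := ⟨matrixInl F M.1, by
    have h := M.2
    rw [Matrix.det_fin_two] at h ⊢
    ext <;> simp [h, matrixInl]⟩
  map_one' := by
    refine Subtype.ext (Matrix.ext fun i j => ?_)
    fin_cases i <;> fin_cases j <;> rfl
  map_mul' M N := Subtype.ext (matrixInl_mul M.1 N.1)

theorem specialLinearInl_injective (L F : Type*) [CommRing L] [CommRing F] :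
    Function.Injective (specialLinearInl L F) := by
  intro M N h
  refine Subtype.ext (Matrix.ext fun i j => ?_)
  exact congrArg (fun A : SpecialLinearGroup (Fin 2) (L × F) => (A.1 i j).1) h

theorem specialLinearInl_mul_scalar (L F : Type*) [CommRing L] [CommRing F]
    (M : SpecialLinearGroup (Fin 2) L) :
    (specialLinearInl L F M).1 * Matrix.scalar (Fin 2) (0, 1) = Matrix.scalar (Fin 2) (0, 1) := by
  change matrixInl F M.1 * _ = _
  refine Matrix.ext fun i j => ?_
  fin_cases i <;> fin_cases j <;> simp [matrixInl]

/-- The representation of `L × F` on `F^ι ⊕ F^κ`, where `ι` indexes a basis of `L`, with `L` acting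
by multiplication on the first summand and `F` by scalars on the second. -/
noncomputable def blockRepresentation {F L ι κ : Type*} [Field F] [Field L] [Algebra F L]
    [Fintype ι] [DecidableEq ι] [Fintype κ] [DecidableEq κ] (b : Basis ι F L) :
    L × F →+* Matrix (ι ⊕ κ) (ι ⊕ κ) F where
  toFun x := fromBlocks (Algebra.leftMulMatrix b x.1) 0 0 (Matrix.scalar κ x.2)
  map_one' := by simp
  map_zero' := by simp
  map_mul' x y := by simp [fromBlocks_multiply]
  map_add' x y := by simp [fromBlocks_add]

/-- The entries are `Tr(bᵢ x bⱼ)`, symmetric by commutativity: multiplication is self-adjoint for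
the trace form. -/
theorem transpose_traceMatrix_mul_leftMulMatrix {F L ι : Type*} [Field F] [Field L] [Algebra F L]
    [Fintype ι] [DecidableEq ι] (b : Basis ι F L) (x : L) :
    (Algebra.traceMatrix F b * Algebra.leftMulMatrix b x)ᵀ =
      Algebra.traceMatrix F b * Algebra.leftMulMatrix b x := by
  have key : ∀ i j, (Algebra.traceMatrix F b * Algebra.leftMulMatrix b x) i j =
      Algebra.trace F L (b i * (x * b j)) := by
    intro i j
    rw [Matrix.mul_apply, ← b.sum_repr (x * b j), Finset.mul_sum, map_sum]
    refine Finset.sum_congr rfl fun k _ => ?_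
    rw [Algebra.leftMulMatrix_eq_repr_mul, Algebra.traceMatrix_apply, Algebra.traceForm_apply,
      mul_smul_comm, map_smul, smul_eq_mul, mul_comm]
  ext i j
  rw [Matrix.transpose_apply, key, key]
  congr 1
  ring

/-- Odd prime powers dividing `q ^ (2 * i) - 1` with `i < m` are orders of elements of `Sp` that
fix a pair of nonorthogonal vectors. -/
theorem exists_orderOf_symplectic_fixed_pair {l F : Type*} [DecidableEq l] [Fintype l] [Field F]
    [Finite F] (r : ℕ) [Fact r.Prime] [CharP F r] {i : ℕ} (hi : 0 < i) (hil : i < Fintype.card l)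
    {p k : ℕ} (hp : p.Prime) (hp2 : p ≠ 2) (h : p ^ k ∣ Nat.card F ^ (2 * i) - 1) :
    ∃ g : symplecticGroup l F, orderOf g = p ^ k ∧
      ∃ u u', g.1 *ᵥ u = u ∧ g.1 *ᵥ u' = u' ∧ symplecticForm l F u u' ≠ 0 := by
  have : NeZero i := ⟨hi.ne'⟩
  -- With `L` of degree `i`, the group `SL₂(L)` acts on a symplectic space of dimension `2 i` over
  -- `F`. The second factor of `L × F` carries the remaining `m - i > 0` pairs of coordinates, on
  -- which the element acts trivially.
  let L := FiniteField.Extension F r i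
  have : CharP L r := charP_of_injective_algebraMap (algebraMap F L).injective r
  have hL : Nat.card L = Nat.card F ^ i := FiniteField.natCard_extension F r i
  obtain ⟨M, hM⟩ := exists_orderOf_specialLinear L r hp hp2 (k := k)
    (by rwa [hL, ← pow_mul, mul_comm])
  let b : Basis (Fin i) F L :=
    Module.finBasisOfFinrankEq F L (FiniteField.finrank_extension F r i)
  let e : Fin i ⊕ Fin (Fintype.card l - i) ≃ l :=
    Fintype.equivOfCardEq (by rw [Fintype.card_sum, Fintype.card_fin, Fintype.card_fin]; omega)
  let ρ := Matrix.reindexAlgEquiv F F e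
  have hρt : ∀ A, (ρ A)ᵀ = ρ Aᵀ := fun A => rfl
  let θ : L × F →+* Matrix l l F :=
    ρ.toRingEquiv.toRingHom.comp (blockRepresentation (κ := Fin (Fintype.card l - i)) b)
  have hθ : ∀ x, θ x = ρ (blockRepresentation b x) := fun x => rfl
  -- The trace form on `L`, nondegenerate because `L` is separable over `F`, plus the standard dot
  -- product on the complement.
  let P₀ : Matrix (Fin i ⊕ Fin (Fintype.card l - i)) (Fin i ⊕ Fin (Fintype.card l - i)) F :=
    fromBlocks (Algebra.traceMatrix F b) 0 0 1
  let P := ρ P₀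
  have hPdet : IsUnit P.det := by
    have h1 : P.det = P₀.det := Matrix.det_reindex_self e _
    rw [h1, Matrix.det_fromBlocks_zero₂₁, Matrix.det_one, mul_one,
      Algebra.traceMatrix_of_basis]
    exact (det_traceForm_ne_zero b).isUnit
  have hPt : Pᵀ = P := by
    rw [hρt, fromBlocks_transpose]
    have h1 : (Algebra.traceMatrix F b)ᵀ = Algebra.traceMatrix F b := by
      ext i j
      rw [Matrix.transpose_apply, Algebra.traceMatrix_apply, Algebra.traceMatrix_apply,
        Algebra.traceForm_apply, Algebra.traceForm_apply, mul_comm]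
    rw [h1, Matrix.transpose_zero, Matrix.transpose_zero, Matrix.transpose_one]
  have hPθ : ∀ x, (P * θ x)ᵀ = P * θ x := by
    intro x
    rw [hθ, ← map_mul, hρt]
    congr 1
    simp only [P₀, blockRepresentation, RingHom.coe_mk, MonoidHom.coe_mk, OneHom.coe_mk,
      fromBlocks_multiply, fromBlocks_transpose]
    simp [transpose_traceMatrix_mul_leftMulMatrix, -Matrix.transpose_mul]
  have hinj : Function.Injective θ := by
    rw [injective_iff_map_eq_zero]
    intro x hx
    rw [hθ, map_eq_zero_iff ρ ρ.injective] at hx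
    change fromBlocks (Algebra.leftMulMatrix b x.1) 0 0 (Matrix.scalar _ x.2) = 0 at hx
    rw [← fromBlocks_zero, fromBlocks_inj] at hx
    have : Nonempty (Fin (Fintype.card l - i)) := ⟨⟨0, by omega⟩⟩
    refine Prod.ext ?_ ?_
    · exact (map_eq_zero_iff _ (Algebra.leftMulMatrix_injective b)).1 hx.1
    · exact Matrix.scalar_inj.1 (hx.2.2.2.trans (map_zero _).symm)
  have hε0 : θ (0, 1) ≠ 0 := by
    rw [← map_zero θ, hinj.ne_iff]
    simp
  refine ⟨specialLinearToSymplectic θ P hPdet hPt hPθ (specialLinearInl L F M), ?_, ?_⟩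
  · rw [orderOf_injective _ (specialLinearToSymplectic_injective hPdet hPt hPθ hinj),
      orderOf_injective _ (specialLinearInl_injective L F), hM]
  · exact exists_fixed_pair_specialLinearToSymplectic hPdet hPt hPθ (by ext <;> simp) hε0 _
      (specialLinearInl_mul_scalar L F M)

end Torus

/-! ### Elements of odd prime power order -/

section OddOrder

variable {l F : Type*} [DecidableEq l] [Fintype l] [Field F] [CharP F 2]

/-- A symplectic element of odd order preserves a quadratic form. -/
theorem exists_mem_generalOrthogonal_of_odd {g : symplecticGroup l F} (hg : Odd (orderOf g)) :
    ∃ Q : QuadraticForm F (l ⊕ l → F), PolarizesToSymplectic Q ∧ g ∈ generalOrthogonal Q := by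
  have h0 := polarizes_hyperbolicForm l F
  have hsum : ∀ v, (∑ k ∈ Finset.range (orderOf g), formComp (hyperbolicForm l F) (g ^ k)) v =
      ∑ k ∈ Finset.range (orderOf g), hyperbolicForm l F ((g ^ k).1 *ᵥ v) := by
    intro v
    rw [_root_.sum_apply]
    rfl
  -- Averaging over the cyclic group: the sum of the translates is invariant, and it polarizes to an
  -- odd multiple of `B`, which is `B`.
  refine ⟨∑ k ∈ Finset.range (orderOf g), formComp (hyperbolicForm l F) (g ^ k), ?_, ?_⟩
  · intro x y
    rw [QuadraticMap.polar, hsum, hsum, hsum, ← Finset.sum_sub_distrib, ← Finset.sum_sub_distrib]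
    have h1 : ∀ k, hyperbolicForm l F ((g ^ k).1 *ᵥ (x + y)) - hyperbolicForm l F ((g ^ k).1 *ᵥ x) -
        hyperbolicForm l F ((g ^ k).1 *ᵥ y) = symplecticForm l F x y := fun k =>
      h0.formComp (g ^ k) x y
    obtain ⟨n, hn⟩ := hg
    rw [Finset.sum_congr rfl fun k _ => h1 k, Finset.sum_const, Finset.card_range, nsmul_eq_mul, hn,
      Nat.cast_add, Nat.cast_mul, Nat.cast_two, CharTwo.two_eq_zero, zero_mul, zero_add,
      Nat.cast_one, one_mul]
  · intro v
    rw [hsum, hsum]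
    have h1 : ∀ k, hyperbolicForm l F ((g ^ k).1 *ᵥ (g.1 *ᵥ v)) =
        hyperbolicForm l F ((g ^ (k + 1)).1 *ᵥ v) := by
      intro k
      rw [Matrix.mulVec_mulVec, pow_succ, Submonoid.coe_mul]
    rw [Finset.sum_congr rfl fun k _ => h1 k]
    have h2 := Finset.sum_range_succ (fun k => hyperbolicForm l F ((g ^ k).1 *ᵥ v)) (orderOf g)
    rw [Finset.sum_range_succ', pow_orderOf_eq_one, pow_zero] at h2
    exact add_right_cancel h2

omit [CharP F 2] in
theorem formShift_mem_generalOrthogonal {Q : QuadraticForm F (l ⊕ l → F)} {g : symplecticGroup l F}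
    (hg : g ∈ generalOrthogonal Q) {w : l ⊕ l → F} (hw : g.1 *ᵥ w = w) :
    g ∈ generalOrthogonal (formShift Q w) := by
  intro v
  rw [formShift_apply, formShift_apply, hg v, symplecticForm_mulVec_of_fixed hw]

variable [Finite F]

/-- An invariant form cannot vanish on all fixed vectors, because `B` does not. If it has a
Lagrangian, rescale a nonsingular fixed vector until its value leaves the Artin–Schreier image; the
shift along it has minus type and remains invariant. -/
theorem exists_isMinusType_of_fixed_pair [Nonempty l] {g : symplecticGroup l F}
    (hg : Odd (orderOf g)) {u u' : l ⊕ l → F} (hu : g.1 *ᵥ u = u) (hu' : g.1 *ᵥ u' = u')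
    (huu' : symplecticForm l F u u' ≠ 0) :
    ∃ Q : QuadraticForm F (l ⊕ l → F), PolarizesToSymplectic Q ∧ IsMinusType Q ∧
      g ∈ generalOrthogonal Q := by
  obtain ⟨Q, hQ, hgQ⟩ := exists_mem_generalOrthogonal_of_odd hg
  by_cases hm : IsMinusType Q
  · exact ⟨Q, hQ, hm, hgQ⟩
  rw [isMinusType_iff_not_hasLagrangian hQ, not_not] at hm
  obtain ⟨w, hw, hQw⟩ : ∃ w, g.1 *ᵥ w = w ∧ Q w ≠ 0 := by
    by_contra! h
    apply huu'
    have h1 := hQ.map_add u u'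
    rw [h u hu, h u' hu', h (u + u') (by rw [Matrix.mulVec_add, hu, hu'])] at h1
    simpa using h1.symm
  obtain ⟨b, hb⟩ := exists_notMem_range_artinSchreier (F := F)
  obtain ⟨c, hc⟩ := (frobeniusEquiv F 2).surjective (b / Q w)
  rw [frobeniusEquiv_apply, frobenius_def] at hc
  refine ⟨formShift Q (c • w), hQ.formShift _, ?_,
    formShift_mem_generalOrthogonal hgQ (by rw [Matrix.mulVec_smul, hw])⟩
  rw [isMinusType_iff_not_hasLagrangian (hQ.formShift _), hm.formShift_iff hQ,
    QuadraticMap.map_smul, ← sq, hc, smul_eq_mul, div_mul_cancel₀ _ hQw]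
  exact hb

theorem two_mul_card_dotProduct_notMem {x : l → F} (hx : x ≠ 0) :
    2 * Nat.card {y : l → F // ∑ i, x i * y i ∉ (artinSchreier F).range} =
      Nat.card F ^ Fintype.card l := by
  let f : (l → F) →+ F := AddMonoidHom.mk' (fun y => ∑ i, x i * y i) fun y z => by
    simp [mul_add, Finset.sum_add_distrib]
  have hf : Function.Surjective f := by
    obtain ⟨i, hi⟩ := Function.ne_iff.1 hx
    intro c
    refine ⟨Pi.single i (c / x i), ?_⟩
    change ∑ j, x j * (Pi.single i (c / x i) : l → F) j = c
    rw [Finset.sum_eq_single i]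
    · rw [Pi.single_eq_same, mul_div_cancel₀ _ hi]
    · intro j _ hj
      rw [Pi.single_eq_of_ne hj, mul_zero]
    · simp
  have h1 := ((artinSchreier F).range.comap f).card_mul_index
  rw [AddSubgroup.index_comap_of_surjective _ hf, index_range_artinSchreier] at h1
  have h2 : Nat.card {y : l → F // y ∈ (artinSchreier F).range.comap f} +
      Nat.card {y : l → F // y ∉ (artinSchreier F).range.comap f} = Nat.card (l → F) := by
    classical
    rw [← Nat.card_sum]
    exact Nat.card_congr (Equiv.sumCompl _)
  have h3 : Nat.card (l → F) = Nat.card F ^ Fintype.card l := by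
    rw [Nat.card_fun, Nat.card_eq_fintype_card (α := l)]
  change Nat.card {y : l → F // y ∈ (artinSchreier F).range.comap f} * 2 = _ at h1
  change 2 * Nat.card {y : l → F // y ∉ (artinSchreier F).range.comap f} = _
  omega

/-- Fibre over the first half `x` of the coordinates: `x = 0` contributes nothing, and for each
other `x` exactly half of the `y` qualify. This counts the minus forms, through `minusFormEquiv`. -/
theorem two_mul_card_hyperbolicForm_notMem :
    2 * Nat.card {v : l ⊕ l → F // hyperbolicForm l F v ∉ (artinSchreier F).range} =
      (Nat.card F ^ Fintype.card l - 1) * Nat.card F ^ Fintype.card l := by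
  classical
  have := Fintype.ofFinite F
  have e : {v : l ⊕ l → F // hyperbolicForm l F v ∉ (artinSchreier F).range} ≃
      Σ x : l → F, {y : l → F // ∑ i, x i * y i ∉ (artinSchreier F).range} :=
    { toFun := fun v => ⟨fun i => v.1 (.inl i), fun i => v.1 (.inr i), by
        rw [← hyperbolicForm_apply]; exact v.2⟩
      invFun := fun p => ⟨Sum.elim p.1 p.2.1, by
        rw [hyperbolicForm_apply]; exact p.2.2⟩
      left_inv := fun v => Subtype.ext (by ext (i | i) <;> rfl)
      right_inv := fun p => rfl }
  rw [Nat.card_congr e, Nat.card_sigma, Finset.mul_sum,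
    ← Finset.add_sum_erase _ _ (Finset.mem_univ (0 : l → F))]
  have h0 : Nat.card {y : l → F // ∑ i, (0 : l → F) i * y i ∉ (artinSchreier F).range} = 0 := by
    rw [Nat.card_eq_zero]
    left
    refine ⟨fun y => y.2 ?_⟩
    simp
  rw [h0, mul_zero, zero_add, Finset.sum_congr rfl fun x hx =>
    two_mul_card_dotProduct_notMem (Finset.ne_of_mem_erase hx), Finset.sum_const,
    Finset.card_erase_of_mem (Finset.mem_univ _), Finset.card_univ, smul_eq_mul,
    ← Nat.card_eq_fintype_card, Nat.card_fun, Nat.card_eq_fintype_card (α := l)]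

variable (l F) in
/-- The forms of minus type polarizing to the symplectic form. -/
abbrev MinusForm : Type _ :=
  {Q : QuadraticForm F (l ⊕ l → F) // PolarizesToSymplectic Q ∧ IsMinusType Q}

variable (l F) in
/-- Forms of minus type as shifts of the hyperbolic form. -/
noncomputable def minusFormEquiv [Nonempty l] :
    {v : l ⊕ l → F // hyperbolicForm l F v ∉ (artinSchreier F).range} ≃ MinusForm l F :=
  Equiv.ofBijective (fun v => ⟨formShift (hyperbolicForm l F) v.1,
    (polarizes_hyperbolicForm l F).formShift _, by
      rw [isMinusType_iff_not_hasLagrangian ((polarizes_hyperbolicForm l F).formShift _),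
        hasLagrangian_hyperbolicForm.formShift_iff (polarizes_hyperbolicForm l F)]
      exact v.2⟩) (by
    constructor
    · intro v w h
      exact Subtype.ext (formShift_injective _ (congrArg Subtype.val h))
    · rintro ⟨Q, hQ, hm⟩
      obtain ⟨u, rfl⟩ := exists_formShift_eq (polarizes_hyperbolicForm l F) hQ
      rw [isMinusType_iff_not_hasLagrangian hQ,
        hasLagrangian_hyperbolicForm.formShift_iff (polarizes_hyperbolicForm l F)] at hm
      exact ⟨⟨u, hm⟩, rfl⟩)

omit [Finite F] [CharP F 2] in
theorem IsMinusType.formComp {Q : QuadraticForm F (l ⊕ l → F)} (h : IsMinusType Q)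
    (A : symplecticGroup l F) : IsMinusType (formComp Q A) := by
  obtain ⟨k, hk, h⟩ := h
  exact ⟨k, hk, h.formComp A⟩

/-- The action of a symplectic element on the forms of minus type. -/
def minusFormPerm (g : symplecticGroup l F) : Equiv.Perm (MinusForm l F) where
  toFun Q := ⟨formComp Q.1 g, Q.2.1.formComp g, Q.2.2.formComp g⟩
  invFun Q := ⟨formComp Q.1 g⁻¹, Q.2.1.formComp _, Q.2.2.formComp _⟩
  left_inv Q := Subtype.ext (by
    change _root_.formComp (_root_.formComp Q.1 g) g⁻¹ = Q.1
    rw [← formComp_mul, mul_inv_cancel, formComp_one])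
  right_inv Q := Subtype.ext (by
    change _root_.formComp (_root_.formComp Q.1 g⁻¹) g = Q.1
    rw [← formComp_mul, inv_mul_cancel, formComp_one])

omit [Finite F] [CharP F 2] in
theorem minusFormPerm_pow_apply (g : symplecticGroup l F) (n : ℕ) (Q : MinusForm l F) :
    ((minusFormPerm g ^ n) Q).1 = formComp Q.1 (g ^ n) := by
  induction n with
  | zero => rw [pow_zero, pow_zero, formComp_one]; rfl
  | succ n ih =>
    rw [pow_succ', pow_succ, formComp_mul, ← ih]
    rfl

/-- A `p`-element preserves a form of minus type if `p` does not divide their number. -/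
theorem exists_isMinusType_of_not_dvd [Nonempty l] {g : symplecticGroup l F} {p k : ℕ}
    (hp : p.Prime) (hg : orderOf g = p ^ k)
    (h1 : ¬ p ∣ Nat.card F ^ Fintype.card l - 1) (h2 : ¬ p ∣ Nat.card F) :
    ∃ Q : QuadraticForm F (l ⊕ l → F), PolarizesToSymplectic Q ∧ IsMinusType Q ∧
      g ∈ generalOrthogonal Q := by
  have := Fact.mk hp
  have : Finite (MinusForm l F) := Finite.of_equiv _ (minusFormEquiv l F)
  have := Fintype.ofFinite (MinusForm l F)
  have hc : ¬ p ∣ Fintype.card (MinusForm l F) := by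
    intro h
    rw [← Nat.card_eq_fintype_card, ← Nat.card_congr (minusFormEquiv l F)] at h
    have h3 := h.mul_left 2
    rw [two_mul_card_hyperbolicForm_notMem, hp.dvd_mul] at h3
    exact h3.elim h1 fun h => h2 (hp.dvd_of_dvd_pow h)
  obtain ⟨Q, hQ⟩ := Equiv.Perm.exists_fixed_point_of_prime (n := k) hc
    (σ := minusFormPerm g) (Equiv.ext fun Q => Subtype.ext (by
      rw [minusFormPerm_pow_apply, ← hg, pow_orderOf_eq_one, formComp_one]
      rfl))
  exact ⟨Q.1, Q.2.1, Q.2.2, fun v => QuadraticMap.congr_fun (congrArg Subtype.val hQ) v⟩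

/-- The element found in `Ω` need not be `g`: for `i < m`, or when `p ∣ q^m - 1`, a new element of
the same order is built, while in the remaining case `g` itself preserves a minus form. -/
theorem prime_pow_dvd_exponent_omegaGroup (hl : Even (Fintype.card l))
    {Q : QuadraticForm F (l ⊕ l → F)} (hQ : PolarizesToSymplectic Q) (hm : IsMinusType Q)
    {p k : ℕ} (hp : p.Prime) (hp2 : p ≠ 2) {g : symplecticGroup l F} (hg : orderOf g = p ^ k) :
    p ^ k ∣ Monoid.exponent (omegaGroup Q hQ) := by
  have := hm.nonempty
  have := Fact.mk hp
  obtain _ | k := k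
  · simp
  have hpF : (p : F) ≠ 0 := by
    rw [Ne, CharP.cast_eq_zero_iff F 2, Nat.prime_dvd_prime_iff_eq Nat.prime_two hp]
    exact hp2.symm
  have hodd : Odd (p ^ (k + 1)) := (hp.odd_of_ne_two hp2).pow
  suffices h : ∃ (g : symplecticGroup l F) (Q' : QuadraticForm F (l ⊕ l → F)),
      orderOf g = p ^ (k + 1) ∧ PolarizesToSymplectic Q' ∧ IsMinusType Q' ∧
        g ∈ generalOrthogonal Q' by
    obtain ⟨g, Q', hg, hQ', hm', hgQ⟩ := h
    rw [← hg]
    exact orderOf_dvd_exponent_omegaGroup hQ hQ' hm hm'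
      (mem_omegaGroup_of_odd_orderOf hQ' hgQ (hg ▸ hodd))
  have small : ∀ i, 0 < i → i < Fintype.card l → p ^ (k + 1) ∣ Nat.card F ^ (2 * i) - 1 →
      ∃ (g : symplecticGroup l F) (Q' : QuadraticForm F (l ⊕ l → F)),
        orderOf g = p ^ (k + 1) ∧ PolarizesToSymplectic Q' ∧ IsMinusType Q' ∧
          g ∈ generalOrthogonal Q' := by
    intro i hi hil hd
    obtain ⟨g, hg, u, u', hu, hu', huu'⟩ :=
      exists_orderOf_symplectic_fixed_pair (l := l) 2 hi hil hp hp2 hd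
    obtain ⟨Q', h1, h2, h3⟩ := exists_isMinusType_of_fixed_pair (hg ▸ hodd) hu hu' huu'
    exact ⟨g, Q', hg, h1, h2, h3⟩
  obtain ⟨i, hi, hil, hd⟩ := dvd_card_pow_sub_one_of_symplectic g hp2 hpF hg
  rcases hil.lt_or_eq with hil | rfl
  · exact small i hi hil hd
  have hq : Nat.card F ^ (2 * Fintype.card l) - 1 =
      (Nat.card F ^ Fintype.card l - 1) * (Nat.card F ^ Fintype.card l + 1) := by
    rw [mul_comm 2, pow_mul, mul_comm, ← Nat.sq_sub_sq, one_pow]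
  -- If `p ∣ q^m - 1`, the odd prime `p` does not divide `q^m + 1`, so the whole prime power divides
  -- `q^m - 1`. Evenness of `m` makes this the case `i = m / 2 < m`.
  by_cases hpd : p ∣ Nat.card F ^ Fintype.card l - 1
  · have hpos : 0 < Nat.card F ^ Fintype.card l := pow_pos Nat.card_pos _
    have hnd : ¬ p ^ (k + 1) ∣ Nat.card F ^ Fintype.card l + 1 := by
      intro h
      have h2 : p ∣ Nat.card F ^ Fintype.card l + 1 := (dvd_pow_self p k.succ_ne_zero).trans h
      have h3 := (Nat.dvd_add_iff_right hpd (n := 2)).2 (by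
        rwa [show Nat.card F ^ Fintype.card l - 1 + 2 = Nat.card F ^ Fintype.card l + 1 by omega])
      exact hp2 ((Nat.prime_dvd_prime_iff_eq hp Nat.prime_two).1 h3)
    have hd' := (prime_pow_dvd_sub_one_or_add_one hp hp2 (hq ▸ hd) hpos).resolve_right hnd
    obtain ⟨j, hj⟩ := hl
    refine small j (by omega) (by omega) ?_
    rwa [two_mul, ← hj]
  · obtain ⟨Q', h1, h2, h3⟩ := exists_isMinusType_of_not_dvd hp hg hpd (by
      intro h
      have h1 : p ∣ 1 := by
        have h4 : p ∣ Nat.card F ^ (2 * Fintype.card l) := dvd_pow h (by omega)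
        have h5 := (dvd_pow_self p k.succ_ne_zero).trans hd
        rwa [Nat.dvd_sub_iff_right (Nat.one_le_pow _ _ Nat.card_pos) h4] at h5
      exact hp.one_lt.ne' (Nat.dvd_one.1 h1))
    exact ⟨g, Q', hg, h1, h2, h3⟩

end OddOrder

/-! ### Unipotent elements -/

section Unipotent

/-- In characteristic two `(M - 1)^(2^j) = M^(2^j) - 1`. So `M - 1` is nilpotent, and by
Cayley–Hamilton its power of exponent the matrix size vanishes. -/
theorem pow_eq_one_of_two_pow {n F : Type*} [DecidableEq n] [Fintype n] [Field F] [CharP F 2]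
    (M : Matrix n n F) {k a : ℕ} (hM : M ^ 2 ^ k = 1) (ha : Fintype.card n ≤ 2 ^ a) :
    M ^ 2 ^ a = 1 := by
  cases isEmpty_or_nonempty n
  · exact Subsingleton.elim _ _
  have hpow : ∀ j, (M - 1) ^ 2 ^ j = M ^ 2 ^ j - 1 := fun j => by
    rw [sub_pow_char_pow_of_commute _ _ (Commute.one_right M), one_pow]
  have hnil : IsNilpotent (M - 1) := ⟨2 ^ k, by rw [hpow, hM, sub_self]⟩
  have h1 := (Matrix.isNilpotent_charpoly_sub_pow_of_isNilpotent hnil).eq_zero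
  have h2 := Matrix.aeval_self_charpoly (M - 1)
  rw [sub_eq_zero.1 h1, map_pow, Polynomial.aeval_X] at h2
  rw [← sub_eq_zero, ← hpow]
  exact pow_eq_zero_of_le ha h2

variable {l F : Type*} [DecidableEq l] [Fintype l] [Field F] [CharP F 2]

/-- The Siegel transformation attached to vectors `e`, `w`. -/
def siegel (Q : QuadraticForm F (l ⊕ l → F)) (e w : l ⊕ l → F) : (l ⊕ l → F) →ₗ[F] (l ⊕ l → F) :=
  LinearMap.id + (LinearMap.BilinForm.flip (symplecticForm l F) w).smulRight e +
    (LinearMap.BilinForm.flip (symplecticForm l F) e).smulRight (w + Q w • e)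

omit [CharP F 2] in
theorem siegel_apply (Q : QuadraticForm F (l ⊕ l → F)) (e w v : l ⊕ l → F) :
    siegel Q e w v = v + symplecticForm l F v w • e + symplecticForm l F v e • (w + Q w • e) := rfl

omit [CharP F 2] in
theorem siegel_zero (Q : QuadraticForm F (l ⊕ l → F)) (e v : l ⊕ l → F) : siegel Q e 0 v = v := by
  simp [siegel_apply]

variable {Q : QuadraticForm F (l ⊕ l → F)} {e : l ⊕ l → F}

theorem map_siegel (hQ : PolarizesToSymplectic Q) (he : Q e = 0) {w : l ⊕ l → F}
    (hw : symplecticForm l F w e = 0) (v : l ⊕ l → F) : Q (siegel Q e w v) = Q v := by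
  have hew : symplecticForm l F e w = 0 := by rw [symplecticForm_comm, hw]
  rw [siegel_apply]
  simp only [hQ.map_add, QuadraticMap.map_smul, map_add, map_smul, LinearMap.add_apply,
    LinearMap.smul_apply, smul_eq_mul, he, hw, hew, symplecticForm_isAlt.self_eq_zero]
  linear_combination (symplecticForm l F v e ^ 2 * Q w + symplecticForm l F v w *
    symplecticForm l F v e) * (CharTwo.two_eq_zero (R := F))

/-- For fixed `e` the Siegel transformations are additive in `w ⊥ e`; hence in characteristic two
they square to the identity. -/
theorem siegel_siegel (hQ : PolarizesToSymplectic Q) {w w' : l ⊕ l → F}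
    (hw : symplecticForm l F w e = 0) (hw' : symplecticForm l F w' e = 0) (v : l ⊕ l → F) :
    siegel Q e w (siegel Q e w' v) = siegel Q e (w + w') v := by
  have hew : symplecticForm l F e w = 0 := by rw [symplecticForm_comm, hw]
  simp only [siegel_apply, hQ.map_add, map_add, map_smul, hw', hew,
    symplecticForm_isAlt.self_eq_zero]
  rw [symplecticForm_comm w' w]
  module

omit [CharP F 2] in
theorem mulVec_siegel {c : symplecticGroup l F} (hc : c ∈ generalOrthogonal Q)
    (hce : c.1 *ᵥ e = e) (w v : l ⊕ l → F) :
    c.1 *ᵥ siegel Q e w v = siegel Q e (c.1 *ᵥ w) (c.1 *ᵥ v) := by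
  rw [siegel_apply, siegel_apply, symplecticForm_mulVec, hc w, symplecticForm_mulVec_of_fixed hce]
  simp only [Matrix.mulVec_add, Matrix.mulVec_smul, hce]

/-- The Siegel transformation as an element of the symplectic group. -/
def siegelElement (hQ : PolarizesToSymplectic Q) (he : Q e = 0) {w : l ⊕ l → F}
    (hw : symplecticForm l F w e = 0) : symplecticGroup l F :=
  ⟨LinearMap.toMatrix' (siegel Q e w), mem_symplecticGroup_of_isometry hQ fun v => by
    rw [← Matrix.toLin'_apply, Matrix.toLin'_toMatrix', map_siegel hQ he hw]⟩

theorem siegelElement_mulVec (hQ : PolarizesToSymplectic Q) (he : Q e = 0) {w : l ⊕ l → F}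
    (hw : symplecticForm l F w e = 0) (v : l ⊕ l → F) :
    (siegelElement hQ he hw).1 *ᵥ v = siegel Q e w v := by
  rw [siegelElement, ← Matrix.toLin'_apply, Matrix.toLin'_toMatrix']

theorem siegelElement_mem (hQ : PolarizesToSymplectic Q) (he : Q e = 0) {w : l ⊕ l → F}
    (hw : symplecticForm l F w e = 0) : siegelElement hQ he hw ∈ generalOrthogonal Q := fun v => by
  rw [siegelElement_mulVec, map_siegel hQ he hw]

/-- With `σ_w` the Siegel transformation, `c σ_w = σ_{c w} c`, so `(c σ_w)^n` collects into `σ_{c w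
+ ⋯ + c^n w} c^n`. The first conjunct, orthogonality of the sum to `e`, is what lets the induction
apply additivity. -/
theorem mul_siegelElement_pow_mulVec (hQ : PolarizesToSymplectic Q) (he : Q e = 0) {w : l ⊕ l → F}
    (hw : symplecticForm l F w e = 0) {c : symplecticGroup l F} (hc : c ∈ generalOrthogonal Q)
    (hce : c.1 *ᵥ e = e) (n : ℕ) (v : l ⊕ l → F) :
    symplecticForm l F (∑ i ∈ Finset.range n, (c ^ (i + 1)).1 *ᵥ w) e = 0 ∧
    ((c * siegelElement hQ he hw) ^ n).1 *ᵥ v =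
      siegel Q e (∑ i ∈ Finset.range n, (c ^ (i + 1)).1 *ᵥ w) ((c ^ n).1 *ᵥ v) := by
  induction n with
  | zero => simp [siegel_zero]
  | succ n ih =>
    have hsum : ∑ i ∈ Finset.range (n + 1), (c ^ (i + 1)).1 *ᵥ w =
        c.1 *ᵥ (w + ∑ i ∈ Finset.range n, (c ^ (i + 1)).1 *ᵥ w) := by
      rw [Finset.sum_range_succ', Matrix.mulVec_add, Matrix.mulVec_sum, add_comm, zero_add, pow_one]
      congr 1
      refine Finset.sum_congr rfl fun i _ => ?_
      rw [Matrix.mulVec_mulVec, pow_succ' c (i + 1), Submonoid.coe_mul]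
    constructor
    · rw [hsum, symplecticForm_mulVec_of_fixed hce, map_add, LinearMap.add_apply, hw, ih.1, add_zero]
    · rw [hsum, pow_succ', Submonoid.coe_mul, ← Matrix.mulVec_mulVec, ih.2, Submonoid.coe_mul,
        ← Matrix.mulVec_mulVec, siegelElement_mulVec, siegel_siegel hQ hw ih.1,
        mulVec_siegel hc hce, Matrix.mulVec_mulVec, pow_succ' c, Submonoid.coe_mul]

/-! ### A transvection as a reflection -/

theorem rank_symplecticTransvection_sub_one {u : l ⊕ l → F} (hu : u ≠ 0) :
    ((symplecticTransvection 1 u).1 - 1).rank = 1 := by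
  have h1 : LinearMap.range ((symplecticTransvection 1 u).1 - 1).mulVecLin =
      Submodule.span F {u} := by
    obtain ⟨v, hv⟩ : ∃ v, symplecticForm l F v u ≠ 0 := by
      by_contra! h
      exact hu (eq_zero_of_symplecticForm h)
    ext x
    rw [LinearMap.mem_range, Submodule.mem_span_singleton]
    simp only [Matrix.mulVecLin_apply, Matrix.sub_mulVec, Matrix.one_mulVec,
      symplecticTransvection_mulVec, add_sub_cancel_left, one_mul]
    constructor
    · rintro ⟨y, rfl⟩
      exact ⟨_, rfl⟩
    · rintro ⟨a, rfl⟩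
      refine ⟨(a / symplecticForm l F v u) • v, ?_⟩
      rw [map_smul, LinearMap.smul_apply, smul_eq_mul, div_mul_cancel₀ _ hv]
  rw [Matrix.rank, h1, finrank_span_singleton hu]

theorem symplecticTransvection_sq (u : l ⊕ l → F) : symplecticTransvection 1 u ^ 2 = 1 := by
  refine Subtype.ext (Matrix.ext_of_mulVec_single fun i => ?_)
  rw [sq, Submonoid.coe_mul, ← Matrix.mulVec_mulVec, symplecticTransvection_mulVec,
    symplecticTransvection_mulVec, map_add, map_smul, LinearMap.add_apply, LinearMap.smul_apply,
    symplecticForm_isAlt.self_eq_zero, smul_zero, add_zero, add_assoc, ← add_smul,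
    CharTwo.add_self_eq_zero, zero_smul, add_zero, Submonoid.coe_one, Matrix.one_mulVec]

theorem commute_symplecticTransvection {g : symplecticGroup l F} {u : l ⊕ l → F}
    (hg : g.1 *ᵥ u = u) : Commute g (symplecticTransvection 1 u) := by
  refine Subtype.ext (Matrix.ext_of_mulVec_single fun i => ?_)
  rw [Submonoid.coe_mul, Submonoid.coe_mul, ← Matrix.mulVec_mulVec, ← Matrix.mulVec_mulVec,
    symplecticTransvection_mulVec, symplecticTransvection_mulVec, Matrix.mulVec_add,
    Matrix.mulVec_smul, hg, symplecticForm_mulVec_of_fixed hg]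

/-- A `2`-element of `GO(Q)` fixing a vector on which `Q` is `1` can be corrected by a reflection
to lie in `Ω(Q)`. -/
theorem exists_mem_omegaGroup_orderOf_eq (hQ : PolarizesToSymplectic Q) {g : symplecticGroup l F}
    (hg : g ∈ generalOrthogonal Q) {u : l ⊕ l → F} (hgu : g.1 *ᵥ u = u) (hu : Q u = 1) {j : ℕ}
    (h1 : g ^ 2 ^ (j + 1) ≠ 1) (h2 : g ^ 2 ^ (j + 2) = 1) :
    ∃ h ∈ omegaGroup Q hQ, orderOf h = 2 ^ (j + 2) := by
  have h2' := Fact.mk Nat.prime_two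
  by_cases hr : Even (g.1 - 1).rank
  · exact ⟨g, ⟨hg, hr⟩, orderOf_eq_prime_pow h1 h2⟩
  have hu0 : u ≠ 0 := by
    rintro rfl
    rw [QuadraticMap.map_zero] at hu
    exact zero_ne_one hu
  have hcomm := commute_symplecticTransvection hgu
  have hρ : symplecticTransvection 1 u ∈ generalOrthogonal Q := by
    intro v
    rw [← formComp_apply, formComp_symplecticTransvection_apply hQ, hu, one_pow, mul_one,
      CharTwo.add_self_eq_zero, zero_mul, add_zero]
  -- The reflection along `u` is an involution commuting with `g`, so it does not affect even
  -- powers, while its own rank `1` flips the Dickson invariant.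
  have hpow : ∀ i, (g * symplecticTransvection 1 u) ^ 2 ^ (i + 1) = g ^ 2 ^ (i + 1) := by
    intro i
    rw [hcomm.mul_pow, pow_succ' 2, pow_mul (symplecticTransvection 1 u), symplecticTransvection_sq,
      one_pow, mul_one]
  refine ⟨g * symplecticTransvection 1 u, ⟨mul_mem hg hρ, ?_⟩,
    orderOf_eq_prime_pow (by rwa [hpow]) (by rwa [hpow])⟩
  have h3 := even_rank_mul_sub_one_of_mem hQ hg hρ
  rw [rank_symplecticTransvection_sub_one hu0] at h3
  rw [Nat.even_iff] at *
  omega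

end Unipotent

/-! ### A signed cycle -/

section SignedCycle

variable {m s : ℕ}

/-- The cycle `0 → 1 → ⋯ → s - 1 → 0` on `Fin m`. -/
def initialCycle (hs : s ≤ m) (i : Fin m) : Fin m :=
  ⟨if i.1 + 1 < s then i.1 + 1 else if i.1 + 1 = s then 0 else i.1, by
    have := i.2
    split_ifs <;> omega⟩

/-- The cycle of length `2 * s` on two copies of `Fin m`, lifting the cycle of length `s`. -/
def signedCycle (hs : s ≤ m) : Fin m ⊕ Fin m → Fin m ⊕ Fin m
  | .inl i => if i.1 + 1 = s then .inr (initialCycle hs i) else .inl (initialCycle hs i)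
  | .inr i => if i.1 + 1 = s then .inl (initialCycle hs i) else .inr (initialCycle hs i)

theorem initialCycle_bijective (hs : s ≤ m) : Function.Bijective (initialCycle hs) := by
  rw [← Finite.injective_iff_bijective]
  intro i j h
  have h1 := congrArg Fin.val h
  simp only [initialCycle] at h1
  apply Fin.ext
  split_ifs at h1 <;> omega

theorem signedCycle_swap (hs : s ≤ m) (x : Fin m ⊕ Fin m) :
    signedCycle hs x.swap = (signedCycle hs x).swap := by
  rcases x with i | i <;> by_cases h : i.1 + 1 = s <;> simp [signedCycle, h]

theorem signedCycle_iterate_swap (hs : s ≤ m) (k : ℕ) (x : Fin m ⊕ Fin m) :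
    (signedCycle hs)^[k] x.swap = ((signedCycle hs)^[k] x).swap := by
  induction k generalizing x with
  | zero => rfl
  | succ k ih => rw [Function.iterate_succ_apply, signedCycle_swap, ih, Function.iterate_succ_apply]

theorem signedCycle_of_le (hs : s ≤ m) {i : Fin m} (hi : s ≤ i) :
    signedCycle hs (.inl i) = .inl i ∧ signedCycle hs (.inr i) = .inr i := by
  have h1 : initialCycle hs i = i := by
    apply Fin.ext
    simp only [initialCycle]
    split_ifs <;> omega
  have h2 : i.1 + 1 ≠ s := by omega
  simp [signedCycle, h1, h2]

theorem signedCycle_iterate_inl (hs : s ≤ m) {i j : Fin m} {k : ℕ} (hk : i.1 + k = j.1)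
    (hj : j.1 < s) : (signedCycle hs)^[k] (.inl i) = .inl j := by
  induction k generalizing i with
  | zero => exact congrArg Sum.inl (Fin.ext hk)
  | succ k ih =>
    have h1 : i.1 + 1 ≠ s := by omega
    have h2 : (initialCycle hs i).1 = i.1 + 1 := by
      simp only [initialCycle]
      rw [if_pos (by omega)]
    rw [Function.iterate_succ_apply, signedCycle, if_neg h1]
    exact ih (by omega)

theorem signedCycle_iterate_inl_add (hs : s ≤ m) {i j : Fin m} {k : ℕ} (hi : i.1 < s)
    (hk : i.1 + k = j.1 + s) (hj : j.1 < s) : (signedCycle hs)^[k] (.inl i) = .inr j := by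
  have hm : 0 < m := by omega
  obtain ⟨d, rfl⟩ : ∃ d, k = j.1 + (1 + d) := ⟨k - j.1 - 1, by omega⟩
  have h1 : (signedCycle hs)^[d] (.inl i) = .inl ⟨s - 1, by omega⟩ :=
    signedCycle_iterate_inl hs (by simp only; omega) (by simp only; omega)
  have h2 : signedCycle hs (.inl ⟨s - 1, by omega⟩) = .inr ⟨0, hm⟩ := by
    have h3 : s - 1 + 1 = s := by omega
    simp [signedCycle, initialCycle, h3]
  rw [Function.iterate_add_apply, Function.iterate_add_apply, h1, Function.iterate_one, h2]
  have h4 := signedCycle_iterate_swap hs j.1 (.inl ⟨0, hm⟩)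
  rw [signedCycle_iterate_inl hs (j := j) (by simp) hj] at h4
  exact h4

theorem signedCycle_iterate_two_mul (hs : s ≤ m) (x : Fin m ⊕ Fin m) :
    (signedCycle hs)^[2 * s] x = x := by
  have key : ∀ i : Fin m, (signedCycle hs)^[2 * s] (.inl i) = .inl i := by
    intro i
    by_cases hi : i.1 < s
    · have h1 := signedCycle_iterate_inl_add hs (j := i) hi rfl hi
      have h2 := signedCycle_iterate_swap hs s (.inl i)
      rw [h1] at h2
      rw [two_mul, Function.iterate_add_apply, h1]
      exact h2
    · exact Function.iterate_fixed (signedCycle_of_le hs (by omega)).1 _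
  rcases x with i | i
  · exact key i
  · have := signedCycle_iterate_swap hs (2 * s) (.inl i)
    rw [key] at this
    exact this

theorem signedCycle_injective (hs : s ≤ m) (h0 : 0 < s) :
    Function.Injective (signedCycle hs) := by
  have h1 : Function.LeftInverse ((signedCycle hs)^[2 * s - 1]) (signedCycle hs) := by
    intro x
    rw [← Function.iterate_succ_apply, show (2 * s - 1).succ = 2 * s by omega,
      signedCycle_iterate_two_mul]
  exact h1.injective

variable {F : Type*} [Field F]

theorem hyperbolicForm_comp_signedCycle (hs : s ≤ m) (v : Fin m ⊕ Fin m → F) :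
    hyperbolicForm (Fin m) F (v ∘ signedCycle hs) = hyperbolicForm (Fin m) F v := by
  rw [hyperbolicForm_apply, hyperbolicForm_apply,
    ← (initialCycle_bijective hs).sum_comp (fun i => v (.inl i) * v (.inr i))]
  refine Finset.sum_congr rfl fun i _ => ?_
  by_cases h : i.1 + 1 = s
  · simp [signedCycle, h, mul_comm]
  · simp [signedCycle, h]

variable [CharP F 2]

variable (F) in
/-- The signed cycle as an isometry of the hyperbolic form. -/
def signedCycleElement (hs : s ≤ m) : symplecticGroup (Fin m) F :=
  ⟨LinearMap.toMatrix' (LinearMap.funLeft F F (signedCycle hs)),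
    mem_symplecticGroup_of_isometry (polarizes_hyperbolicForm (Fin m) F) fun v => by
      rw [← Matrix.toLin'_apply, Matrix.toLin'_toMatrix']
      exact hyperbolicForm_comp_signedCycle hs v⟩

theorem signedCycleElement_mulVec (hs : s ≤ m) (v : Fin m ⊕ Fin m → F) :
    (signedCycleElement F hs).1 *ᵥ v = v ∘ signedCycle hs := by
  rw [signedCycleElement, ← Matrix.toLin'_apply, Matrix.toLin'_toMatrix']
  rfl

theorem signedCycleElement_pow_mulVec (hs : s ≤ m) (k : ℕ) (v : Fin m ⊕ Fin m → F) :
    (signedCycleElement F hs ^ k).1 *ᵥ v = v ∘ (signedCycle hs)^[k] := by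
  induction k generalizing v with
  | zero => simp
  | succ k ih =>
    rw [pow_succ, Submonoid.coe_mul, ← Matrix.mulVec_mulVec, ih, signedCycleElement_mulVec,
      Function.iterate_succ', Function.comp_assoc]

theorem signedCycleElement_mem (hs : s ≤ m) :
    signedCycleElement F hs ∈ generalOrthogonal (hyperbolicForm (Fin m) F) := fun v => by
  rw [signedCycleElement_mulVec, hyperbolicForm_comp_signedCycle]

theorem signedCycleElement_pow_two_mul (hs : s ≤ m) : signedCycleElement F hs ^ (2 * s) = 1 := by
  refine Subtype.ext (Matrix.ext_of_mulVec_single fun i => ?_)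
  rw [signedCycleElement_pow_mulVec, Submonoid.coe_one, Matrix.one_mulVec]
  ext x
  rw [Function.comp_apply, signedCycle_iterate_two_mul]

theorem signedCycleElement_mulVec_single (hs : s ≤ m) (h0 : 0 < s) {x : Fin m ⊕ Fin m}
    (hx : signedCycle hs x = x) (b : F) :
    (signedCycleElement F hs).1 *ᵥ Pi.single x b = Pi.single x b := by
  rw [signedCycleElement_mulVec]
  ext y
  have h1 : signedCycle hs y = x ↔ y = x := by
    rw [← (signedCycle_injective hs h0).eq_iff (a := y), hx]
  simp only [Function.comp_apply, Pi.single_apply, h1]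

/-- The orbit of a basis vector returns to its start only after the full `2 * s` steps, so nothing
cancels in this coordinate. -/
theorem sum_signedCycleElement_pow_mulVec_apply (hs : s ≤ m) (h0 : 0 < s) :
    (∑ i ∈ Finset.range (2 * s), (signedCycleElement F hs ^ (i + 1)).1 *ᵥ
      Pi.single (.inl ⟨0, by omega⟩) (1 : F)) (.inl ⟨0, by omega⟩) = 1 := by
  rw [Finset.sum_apply, Finset.sum_eq_single (2 * s - 1)]
  · rw [signedCycleElement_pow_mulVec, Function.comp_apply, show 2 * s - 1 + 1 = 2 * s by omega,
      signedCycle_iterate_two_mul, Pi.single_eq_same]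
  · intro i hi hne
    rw [Finset.mem_range] at hi
    rw [signedCycleElement_pow_mulVec, Function.comp_apply]
    by_cases h : i + 1 < s
    · rw [signedCycle_iterate_inl hs (j := ⟨i + 1, by omega⟩) (by simp) h]
      simp
    · rw [signedCycle_iterate_inl_add hs (j := ⟨i + 1 - s, by omega⟩) h0
        (by simp only; omega) (by simp only; omega)]
      simp
  · intro h
    simp at h
    omega

/-- The signed cycle `c` on the first `2^j` pairs has `c^(2^(j+1)) = 1`. Multiplied by a Siegel
transformation, it has as its power of exponent `2^(j+1)` the Siegel transformation of the orbit sum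
`W`, an involution; so the order is `2^(j+2)`. -/
theorem exists_mem_omegaGroup_orderOf_two_pow [Finite F] {j : ℕ} (hj : 2 ^ j + 2 ≤ m) :
    ∃ (Q : QuadraticForm F (Fin m ⊕ Fin m → F)) (hQ : PolarizesToSymplectic Q), IsMinusType Q ∧
      ∃ g ∈ omegaGroup Q hQ, orderOf g = 2 ^ (j + 2) := by
  have h0 : 0 < 2 ^ j := by positivity
  have hs : 2 ^ j ≤ m := by omega
  have hH := polarizes_hyperbolicForm (Fin m) F
  obtain ⟨b, hb⟩ := exists_notMem_range_artinSchreier (F := F)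
  -- The cycle occupies the indices below `2^j`, and `e` sits at index `2^j`. The bound `2^j + 2 ≤
  -- m` leaves the last index `κ` untouched by both.
  set κ : Fin m := ⟨m - 1, by omega⟩ with hκ
  set e : Fin m ⊕ Fin m → F := Pi.single (.inl ⟨2 ^ j, by omega⟩) 1 with he
  set w : Fin m ⊕ Fin m → F := Pi.single (.inl ⟨0, by omega⟩) 1 with hw
  set f : Fin m ⊕ Fin m → F := Pi.single (.inr ⟨0, by omega⟩) 1 with hf
  have hQe : hyperbolicForm (Fin m) F e = 0 := by simp [hyperbolicForm_apply, he]
  have hwe : symplecticForm (Fin m) F w e = 0 := by simp [symplecticForm_apply, he, hw]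
  set c := signedCycleElement F hs with hc
  have hce : c.1 *ᵥ e = e :=
    signedCycleElement_mulVec_single hs h0 (signedCycle_of_le hs le_rfl).1 1
  have hcm : c ∈ generalOrthogonal (hyperbolicForm (Fin m) F) := signedCycleElement_mem hs
  set g := c * siegelElement hH hQe hwe with hg
  set W := ∑ i ∈ Finset.range (2 * 2 ^ j), (c ^ (i + 1)).1 *ᵥ w with hW
  have hWe : symplecticForm (Fin m) F W e = 0 :=
    (mul_siegelElement_pow_mulVec hH hQe hwe hcm hce (2 * 2 ^ j) 0).1
  have hgN : ∀ v, (g ^ 2 ^ (j + 1)).1 *ᵥ v = siegel (hyperbolicForm (Fin m) F) e W v := by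
    intro v
    have h1 := (mul_siegelElement_pow_mulVec hH hQe hwe hcm hce (2 * 2 ^ j) v).2
    rw [hc, signedCycleElement_pow_two_mul, ← hc, Submonoid.coe_one, Matrix.one_mulVec] at h1
    rw [pow_succ' 2]
    exact h1
  -- The vector `f` dual to `w` is orthogonal to `e` and pairs to `1` with `W`, so this power sends
  -- `f` to `f + e`.
  have hg1 : g ^ 2 ^ (j + 1) ≠ 1 := by
    intro h
    have h1 := hgN f
    have h2 : symplecticForm (Fin m) F f W = 1 := by
      have h3 : symplecticForm (Fin m) F f W = W (.inl ⟨0, by omega⟩) := by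
        simp [symplecticForm_apply, hf, Pi.single_apply]
      rw [h3]
      exact sum_signedCycleElement_pow_mulVec_apply hs h0
    have h3 : symplecticForm (Fin m) F f e = 0 := by
      simp [symplecticForm_apply, hf, he, Pi.single_apply]
    rw [h, siegel_apply, h2, h3, zero_smul, one_smul, add_zero, Submonoid.coe_one,
      Matrix.one_mulVec, left_eq_add] at h1
    have h4 := congrFun h1 (.inl ⟨2 ^ j, by omega⟩)
    simp [he] at h4
  have hg2 : g ^ 2 ^ (j + 2) = 1 := by
    refine Subtype.ext (Matrix.ext_of_mulVec_single fun i => ?_)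
    rw [pow_succ 2 (j + 1), mul_two, pow_add, Submonoid.coe_mul, ← Matrix.mulVec_mulVec, hgN, hgN,
      siegel_siegel hH hWe hWe, ← two_smul F W, CharTwo.two_eq_zero, zero_smul, siegel_zero,
      Submonoid.coe_one, Matrix.one_mulVec]
  have hfix : ∀ a, g.1 *ᵥ diagVec κ a = diagVec κ a := by
    intro a
    have hκ1 : (⟨0, by omega⟩ : Fin m) ≠ κ := by simp [hκ]; omega
    have hκ2 : (⟨2 ^ j, by omega⟩ : Fin m) ≠ κ := by simp [hκ]; omega
    have h1 : symplecticForm (Fin m) F (diagVec κ a) w = 0 := by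
      rw [symplecticForm_comm, symplecticForm_diagVec]
      simp [hw, hκ1.symm]
    have h2 : symplecticForm (Fin m) F (diagVec κ a) e = 0 := by
      rw [symplecticForm_comm, symplecticForm_diagVec]
      simp [he, hκ2.symm]
    have hle : 2 ^ j ≤ κ.1 := by simp only [hκ]; omega
    rw [hg, Submonoid.coe_mul, ← Matrix.mulVec_mulVec, siegelElement_mulVec, siegel_apply, h1, h2,
      zero_smul, zero_smul, add_zero, add_zero, diagVec, Matrix.mulVec_add, hc,
      signedCycleElement_mulVec_single hs h0 (signedCycle_of_le hs hle).1,
      signedCycleElement_mulVec_single hs h0 (signedCycle_of_le hs hle).2]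
  have hgH : g ∈ generalOrthogonal (hyperbolicForm (Fin m) F) :=
    mul_mem hcm (siegelElement_mem hH hQe hwe)
  refine ⟨formShift (hyperbolicForm (Fin m) F) (diagVec κ b), hH.formShift _,
    isMinusType_formShift_hyperbolicForm κ hb, ?_⟩
  -- The shift is along the same pair, but its contribution at this vector is `(b (1 + 1))² = 0`, so
  -- the value stays `1`.
  refine exists_mem_omegaGroup_orderOf_eq _ (u := diagVec κ 1)
    (formShift_mem_generalOrthogonal hgH (hfix b)) (hfix 1) ?_ hg1 hg2
  rw [formShift_apply, hyperbolicForm_diagVec, symplecticForm_diagVec]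
  simp [diagVec, CharTwo.add_self_eq_zero]

end SignedCycle

/-! ### Comparison of exponents and the main theorem. -/

theorem exponent_omegaGroup {F : Type*} [Field F] [Finite F] [CharP F 2] {m : ℕ} (hm : 4 ≤ m)
    (hme : Even m) {Q : QuadraticForm F (Fin m ⊕ Fin m → F)} (hQ : PolarizesToSymplectic Q)
    (h : IsMinusType Q) :
    Monoid.exponent (omegaGroup Q hQ) = Monoid.exponent (symplecticGroup (Fin m) F) := by
  have : Finite (symplecticGroup (Fin m) F) := Subtype.finite
  refine Nat.dvd_antisymm (Monoid.exponent_submonoid_dvd (omegaGroup Q hQ).toSubmonoid) ?_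
  refine exponent_dvd_of_prime_pow fun p k g hp hg => ?_
  by_cases hp2 : p = 2
  · subst hp2
    -- The least power `2^a` that is at least the matrix size `2 * m` bounds the orders of
    -- 2-elements; `m ≥ 4` gives `a ≥ 3`.
    have h1 : 2 * m ≤ 2 ^ Nat.clog 2 (2 * m) := Nat.le_pow_clog one_lt_two _
    have h2 : 2 ^ (Nat.clog 2 (2 * m) - 1) < 2 * m :=
      Nat.pow_pred_clog_lt_self one_lt_two (by omega)
    generalize Nat.clog 2 (2 * m) = a at h1 h2
    have h3 : 3 ≤ a := by
      by_contra! h3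
      have : 2 ^ a ≤ 2 ^ 2 := Nat.pow_le_pow_right two_pos (by omega)
      omega
    obtain ⟨j, rfl⟩ : ∃ j, a = j + 3 := ⟨a - 3, by omega⟩
    have h4 : orderOf g ∣ 2 ^ (j + 3) := by
      refine orderOf_dvd_of_pow_eq_one (Subtype.ext ?_)
      rw [SubmonoidClass.coe_pow]
      refine pow_eq_one_of_two_pow g.1 (k := k) ?_ ?_
      · rw [← SubmonoidClass.coe_pow, ← hg, pow_orderOf_eq_one, Submonoid.coe_one]
      · simpa [← two_mul] using h1
    -- Minimality of `a = j + 3` gives `2^(j+1) < m`. Both sides are even, so `2^(j+1) + 2 ≤ m`,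
    -- exactly the room that the construction needs.
    obtain ⟨n, hn⟩ := hme
    have h5 : 2 ^ (j + 3 - 1) = 4 * 2 ^ j := by
      rw [show j + 3 - 1 = 2 + j by omega, pow_add]
      norm_num
    obtain ⟨Q', hQ', h', g', hg', ho⟩ :=
      exists_mem_omegaGroup_orderOf_two_pow (F := F) (m := m) (j := j + 1) (by
        rw [pow_succ]
        omega)
    rw [← hg]
    refine h4.trans ?_
    rw [show j + 3 = j + 1 + 2 by omega, ← ho]
    exact orderOf_dvd_exponent_omegaGroup hQ hQ' h h' hg'
  · exact prime_pow_dvd_exponent_omegaGroup (by rwa [Fintype.card_fin]) hQ h hp hp2 hg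

theorem mainTheorem5 (F : Type*) [Field F] [Finite F] [CharP F 2] (m : ℕ) (hm : 4 ≤ m)
    (hme : Even m) :
    -- `PSp_{2m}(q)` has a proper subgroup with the same exponent
    (∃ H : Subgroup (ProjectiveSymplecticGroup (Fin m) F),
      H ≠ ⊤ ∧ Monoid.exponent H = Monoid.exponent (ProjectiveSymplecticGroup (Fin m) F)) ∧
    -- forms of minus type that polarize to the symplectic form exist
    (∃ Q : QuadraticForm F (Fin m ⊕ Fin m → F), PolarizesToSymplectic Q ∧ IsMinusType Q) ∧
    -- and for each of them `Ω(Q)` is such a subgroup, both of `Sp_{2m}(q)` and of `PSp_{2m}(q)`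
    (∀ (Q : QuadraticForm F (Fin m ⊕ Fin m → F)) (hQ : PolarizesToSymplectic Q), IsMinusType Q →
      (omegaGroup Q hQ ≠ ⊤ ∧
        Monoid.exponent (omegaGroup Q hQ) = Monoid.exponent (Matrix.symplecticGroup (Fin m) F)) ∧
      Set.InjOn (QuotientGroup.mk' (Subgroup.center (Matrix.symplecticGroup (Fin m) F)))
        (omegaGroup Q hQ) ∧
      (omegaGroup Q hQ).map
          (QuotientGroup.mk' (Subgroup.center (Matrix.symplecticGroup (Fin m) F))) ≠ ⊤ ∧
      Monoid.exponent ((omegaGroup Q hQ).map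
          (QuotientGroup.mk' (Subgroup.center (Matrix.symplecticGroup (Fin m) F)))) =
        Monoid.exponent (ProjectiveSymplecticGroup (Fin m) F)) := by
  have : Nonempty (Fin m) := ⟨⟨0, by omega⟩⟩
  have hbij := mk'_center_symplecticGroup_bijective (l := Fin m) (F := F)
  have key : ∀ (Q : QuadraticForm F (Fin m ⊕ Fin m → F)) (hQ : PolarizesToSymplectic Q),
      IsMinusType Q →
      (omegaGroup Q hQ ≠ ⊤ ∧
        Monoid.exponent (omegaGroup Q hQ) = Monoid.exponent (Matrix.symplecticGroup (Fin m) F)) ∧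
      Set.InjOn (QuotientGroup.mk' (Subgroup.center (Matrix.symplecticGroup (Fin m) F)))
        (omegaGroup Q hQ) ∧
      (omegaGroup Q hQ).map
          (QuotientGroup.mk' (Subgroup.center (Matrix.symplecticGroup (Fin m) F))) ≠ ⊤ ∧
      Monoid.exponent ((omegaGroup Q hQ).map
          (QuotientGroup.mk' (Subgroup.center (Matrix.symplecticGroup (Fin m) F)))) =
        Monoid.exponent (ProjectiveSymplecticGroup (Fin m) F) := by
    intro Q hQ h
    obtain ⟨u, hu, hQu⟩ := h.exists_singular (by rw [Fintype.card_fin]; omega)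
    have htop := omegaGroup_ne_top hQ hu hQu
    have hexp := exponent_omegaGroup hm hme hQ h
    refine ⟨⟨htop, hexp⟩, hbij.1.injOn, fun h => htop ?_, ?_⟩
    · rw [← MonoidHom.range_eq_top_of_surjective _ hbij.2, MonoidHom.range_eq_map] at h
      exact Subgroup.map_injective hbij.1 h
    · rw [← Monoid.exponent_eq_of_mulEquiv (MulEquiv.ofBijective _ hbij), ← hexp]
      exact (Monoid.exponent_eq_of_mulEquiv
        ((omegaGroup Q hQ).equivMapOfInjective _ hbij.1)).symm
  obtain ⟨Q, hQ, h⟩ := exists_isMinusType (l := Fin m) F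
  exact ⟨⟨_, (key Q hQ h).2.2.1, (key Q hQ h).2.2.2⟩, ⟨Q, hQ, h⟩, key⟩
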